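/- Let $\mathbb{C}_+=\{w\in\mathbb{C}:\operatorname{Re} w>0\}$, let $\alpha>-1$, and let $\mathcal{A}^2_\alpha(\mathbb{C}_+)$ be the weighted Bergman space of all analytic functions $f:\mathbb{C}_+\to\mathbb{C}$ with $$\|f\|=\Big(\frac1\pi\int_{-\infty}^{\infty}\int_0^\infty |f(x+iy)|^2x^\alpha\,dx\,dy\Big)^{1/2}<\infty .$$ A bounded linear operator $T$ on a complex normed space $X$ has the positive shadowing property if for every $\varepsilon>0$ there exists $\delta>0$ such that for every sequence $(x_n)_{n\ge1}$ in $X$ with $\|Tx_n-x_{n+1}\|\le\delta$ for all $n\ge1$ there exists $x\in X$ with $\|T^nx-x_n\|\le\varepsilon$ for all $n\ge1$. Theorem. Let $\phi(w)=aw+b$ with $a>0$ and $b\in\mathbb{C}$, $\operatorname{Re} b\ge0$. Then the composition operator $C_\phi f=f\circ\phi$ is a well-defined bounded linear operator on $\mathcal{A}^2_\alpha(\mathbb{C}_+)$, and $C_\phi$ has the positive shadowing property if and only if one of the following holds: (i) $a\in(0,1)$ and $\operatorname{Re} b=0$; (ii) $a>1$. -/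

import Mathlib

open MeasureTheory

/-- The open right half-plane, as a subset of the complex plane. -/
def rightHalfPlaneSet : Set ℂ := {z : ℂ | 0 < z.re}

/-- The open right half-plane `ℂ₊`, as a type. -/
abbrev RightHalfPlane : Type := {z : ℂ // 0 < z.re}

/-- Extension by zero to all of `ℂ` of a function on the open right half-plane. -/
noncomputable def zeroExt (f : RightHalfPlane → ℂ) : ℂ → ℂ :=
  Function.extend Subtype.val f 0

theorem zeroExt_apply (f : RightHalfPlane → ℂ) (w : RightHalfPlane) :
    zeroExt f (w : ℂ) = f w :=
  Subtype.val_injective.extend_apply f 0 w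

theorem zeroExt_of_notMem (f : RightHalfPlane → ℂ) {z : ℂ} (hz : ¬ 0 < z.re) :
    zeroExt f z = 0 := by
  unfold zeroExt
  rw [Function.extend_apply']
  · rfl
  · rintro ⟨w, rfl⟩
    exact hz w.2

theorem zeroExt_zero : zeroExt 0 = 0 := by
  funext z
  by_cases hz : 0 < z.re
  · exact zeroExt_apply 0 ⟨z, hz⟩
  · exact zeroExt_of_notMem 0 hz

theorem zeroExt_add (f g : RightHalfPlane → ℂ) : zeroExt (f + g) = zeroExt f + zeroExt g := by
  funext z
  by_cases hz : 0 < z.re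
  · have h := fun u : RightHalfPlane → ℂ => zeroExt_apply u ⟨z, hz⟩
    simp only at h
    simp [h]
  · simp [zeroExt_of_notMem _ hz]

theorem zeroExt_smul (c : ℂ) (f : RightHalfPlane → ℂ) : zeroExt (c • f) = c • zeroExt f := by
  funext z
  by_cases hz : 0 < z.re
  · have h := fun u : RightHalfPlane → ℂ => zeroExt_apply u ⟨z, hz⟩
    simp only at h
    simp [h]
  · simp [zeroExt_of_notMem _ hz]

/-- The measure `(1/π) x^α dx dy` on the open right half-plane (and zero elsewhere), where
`z = x + i y`. -/
noncomputable def bergmanMeasure (α : ℝ) : Measure ℂ :=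
  ENNReal.ofReal (1 / Real.pi) •
    (volume.restrict rightHalfPlaneSet).withDensity fun z => ENNReal.ofReal (z.re ^ α)

/-- The vector space of all holomorphic functions `f` on the open right half-plane such that
`(1/π) ∫∫ |f(x + i y)|² x^α dx dy < ∞`. -/
noncomputable def bergmanSubmodule (α : ℝ) : Submodule ℂ (RightHalfPlane → ℂ) where
  carrier := {f | DifferentiableOn ℂ (zeroExt f) rightHalfPlaneSet ∧
    MemLp (zeroExt f) 2 (bergmanMeasure α)}
  add_mem' := by
    rintro f g ⟨hf, hf'⟩ ⟨hg, hg'⟩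
    refine ⟨?_, ?_⟩
    · rw [zeroExt_add]; exact hf.add hg
    · rw [zeroExt_add]; exact hf'.add hg'
  zero_mem' := by
    refine ⟨?_, ?_⟩
    · rw [zeroExt_zero]; exact differentiableOn_const 0
    · rw [zeroExt_zero]; exact MemLp.zero
  smul_mem' := by
    rintro c f ⟨hf, hf'⟩
    refine ⟨?_, ?_⟩
    · rw [zeroExt_smul]; exact hf.const_smul c
    · rw [zeroExt_smul]; exact hf'.const_smul c

/-- The weighted Bergman space `A²_α(ℂ₊)`. It is a type of its own, and not merely a submodule of
the space of all functions, so that its topology is that of its norm. -/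
def WeightedBergman (α : ℝ) : Type := bergmanSubmodule α

namespace WeightedBergman

variable {α : ℝ}

noncomputable instance : AddCommGroup (WeightedBergman α) :=
  inferInstanceAs (AddCommGroup (bergmanSubmodule α))

noncomputable instance : Module ℂ (WeightedBergman α) :=
  inferInstanceAs (Module ℂ (bergmanSubmodule α))

instance : FunLike (WeightedBergman α) RightHalfPlane ℂ where
  coe f := f.1
  coe_injective _ _ h := Subtype.ext h

theorem memLp (f : WeightedBergman α) : MemLp (zeroExt f) 2 (bergmanMeasure α) := f.2.2

/-- The canonical linear map from the Bergman space to `L²`. -/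
noncomputable def toLpₗ (α : ℝ) : WeightedBergman α →ₗ[ℂ] Lp ℂ 2 (bergmanMeasure α) where
  toFun f := f.memLp.toLp (zeroExt f)
  map_add' f g := by
    rw [← MemLp.toLp_add]
    exact MemLp.toLp_congr _ _ (Filter.EventuallyEq.of_eq (zeroExt_add f g))
  map_smul' c f := by
    rw [RingHom.id_apply, ← MemLp.toLp_const_smul]
    exact MemLp.toLp_congr _ _ (Filter.EventuallyEq.of_eq (zeroExt_smul c f))

theorem toLpₗ_injective (α : ℝ) : Function.Injective (toLpₗ α) := by
  have hopen : IsOpen rightHalfPlaneSet := isOpen_lt continuous_const Complex.continuous_re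
  intro f g h
  have h1 : zeroExt f =ᵐ[bergmanMeasure α] zeroExt g :=
    (MemLp.toLp_eq_toLp_iff f.memLp g.memLp).1 h
  have hmeas : Measurable fun z : ℂ => ENNReal.ofReal (z.re ^ α) :=
    (Complex.measurable_re.pow_const α).ennreal_ofReal
  have hc : ENNReal.ofReal (1 / Real.pi) ≠ 0 := by
    simp [Real.pi_pos]
  have h2 : zeroExt f =ᵐ[volume.restrict rightHalfPlaneSet] zeroExt g := by
    have h3 : ∀ᵐ z ∂((volume.restrict rightHalfPlaneSet).withDensity
        fun z => ENNReal.ofReal (z.re ^ α)), zeroExt f z = zeroExt g z :=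
      (Measure.ae_ennreal_smul_measure_iff hc).1 h1
    rw [ae_withDensity_iff hmeas] at h3
    filter_upwards [h3, ae_restrict_mem hopen.measurableSet] with z hz hz'
    refine hz ?_
    have : 0 < z.re ^ α := Real.rpow_pos_of_pos hz' α
    simp [this]
  have h4 := Measure.eqOn_open_of_ae_eq h2 hopen f.2.1.continuousOn g.2.1.continuousOn
  apply DFunLike.ext
  intro w
  have := h4 w.2
  rwa [zeroExt_apply, zeroExt_apply] at this

/-- The norm of `L²((1/π) x^α dx dy)` on the Bergman space. -/
noncomputable instance : NormedAddCommGroup (WeightedBergman α) :=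
  NormedAddCommGroup.induced (WeightedBergman α) (Lp ℂ 2 (bergmanMeasure α)) (toLpₗ α)
    (toLpₗ_injective α)

noncomputable instance : NormedSpace ℂ (WeightedBergman α) :=
  NormedSpace.induced ℂ (WeightedBergman α) (Lp ℂ 2 (bergmanMeasure α)) (toLpₗ α)

/-- The norm is `((1/π) ∫∫ |f(x + i y)|² x^α dx dy)^(1/2)`. -/
theorem norm_eq (f : WeightedBergman α) :
    ‖f‖ = Real.sqrt (1 / Real.pi *
      ∫ z in rightHalfPlaneSet, ‖zeroExt f z‖ ^ 2 * z.re ^ α) := by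
  have hopen : IsOpen rightHalfPlaneSet := isOpen_lt continuous_const Complex.continuous_re
  have hmeas : Measurable fun z : ℂ => ENNReal.ofReal (z.re ^ α) :=
    (Complex.measurable_re.pow_const α).ennreal_ofReal
  have h1 : ‖f‖ = (eLpNorm (zeroExt f) 2 (bergmanMeasure α)).toReal :=
    Lp.norm_toLp _ f.memLp
  have h2 := f.memLp.eLpNorm_eq_integral_rpow_norm (by norm_num) (by norm_num)
  rw [h1, h2, ENNReal.toReal_ofReal (by positivity), Real.sqrt_eq_rpow]
  simp only [ENNReal.toReal_ofNat, Real.rpow_ofNat, one_div]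
  congr 1
  unfold bergmanMeasure
  rw [integral_smul_measure, integral_withDensity_eq_integral_toReal_smul hmeas
    (Filter.Eventually.of_forall fun _ => ENNReal.ofReal_lt_top),
    ENNReal.toReal_ofReal (by positivity), one_div, smul_eq_mul]
  congr 1
  refine setIntegral_congr_fun hopen.measurableSet fun z hz => ?_
  have : 0 ≤ z.re ^ α := (Real.rpow_pos_of_pos hz α).le
  simp [ENNReal.toReal_ofReal this, mul_comm]

end WeightedBergman

/-- The affine self-map `w ↦ a w + b` of the open right half-plane, for `a > 0`, `Re b ≥ 0`. -/
def affineSelfMap (a : ℝ) (b : ℂ) (ha : 0 < a) (hb : 0 ≤ b.re) (w : RightHalfPlane) :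
    RightHalfPlane :=
  ⟨(a : ℂ) * (w : ℂ) + b, by
    have h : 0 < a * (w : ℂ).re := mul_pos ha w.2
    simpa using add_pos_of_pos_of_nonneg h hb⟩

/-- The bounded operator `C` on `A²_α(ℂ₊)` is the composition operator `f ↦ f ∘ φ`. -/
def IsCompositionOperator {α : ℝ} (C : WeightedBergman α →L[ℂ] WeightedBergman α)
    (φ : RightHalfPlane → RightHalfPlane) : Prop :=
  ∀ (f : WeightedBergman α) (w : RightHalfPlane), C f w = f (φ w)

section Shadowing

variable {X : Type*} [NormedAddCommGroup X] [NormedSpace ℂ X]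

/-- A sequence `x₁, x₂, …` with `‖T xₙ - xₙ₊₁‖ ≤ δ` for all `n ≥ 1`. -/
def IsPositivePseudoOrbit (T : X →L[ℂ] X) (δ : ℝ) (x : ℕ+ → X) : Prop :=
  ∀ n : ℕ+, ‖T (x n) - x (n + 1)‖ ≤ δ

/-- The positive shadowing property: for every `ε > 0` there is `δ > 0` such that every positive
`δ`-pseudo orbit of `T` is `ε`-shadowed by the orbit of some vector. -/
def HasPositiveShadowing (T : X →L[ℂ] X) : Prop :=
  ∀ ε : ℝ, 0 < ε → ∃ δ : ℝ, 0 < δ ∧ ∀ x : ℕ+ → X, IsPositivePseudoOrbit T δ x →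
    ∃ y : X, ∀ n : ℕ+, ‖(T ^ (n : ℕ)) y - x n‖ ≤ ε

end Shadowing

open scoped ENNReal

/-! Everything rests on the bound ‖C_φ f‖ ≤ √K · a^(-(α+2)/2) · ‖f‖ with K depending on α only.
Dilations contribute the power of a exactly. For a translation with Re b > 0, the mean value
inequality for f² on discs of radius Re b / 2, followed by Tonelli, gives K
(`bergmanEnergy_comp_add_le_of_re_pos`). The n-th power of C_φ has an affine symbol of slope a^n,
and K ignores the translation part, so the powers are bounded by √K · (a^(-(α+2)/2))^n.

If a > 1, the powers decay geometrically and the errors of a pseudo orbit sum up. Shadowing compares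
x₁ with T x rather than x, so dense range is needed too; it follows from the identity theorem
applied to s ↦ ⟨g, f(· + s)⟩ (`denseRange_affineComp`).

If a < 1 and Re b = 0, C_φ is invertible, its inverse S has slope 1/a, and the pulled back points
S^n x_n converge to the shadowing vector.

If a < 1 and Re b > 0, the point b / (1 - a) of the half-plane is fixed by φ. Evaluation there is an
invariant functional, along which a constant small error accumulates linearly.

If a = 1, the powers are bounded, so shadowing would bound all orbit sums, and by Banach–Steinhaus
the operators ∑_{j<n} T^j uniformly in n. Conjugating by dilations replaces b by s b at no cost;
letting s → 0 turns the sum into n times the identity, which is absurd. -/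

theorem isOpen_rightHalfPlaneSet : IsOpen rightHalfPlaneSet :=
  isOpen_lt continuous_const Complex.continuous_re

theorem measurable_rpow_re (α : ℝ) : Measurable fun z : ℂ => ENNReal.ofReal (z.re ^ α) :=
  (Complex.measurable_re.pow_const α).ennreal_ofReal

/-! ### Mean value inequality over discs -/

/-- Integration over a disc in polar coordinates. -/
theorem lintegral_ball_eq_polar {g : ℂ → ℝ≥0∞} (hg : Measurable g) (w : ℂ) (r : ℝ) :
    ∫⁻ u in Metric.ball w r, g u = ∫⁻ ρ in Set.Ioo 0 r, ENNReal.ofReal ρ *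
      ∫⁻ θ in Set.Ioo (-Real.pi) Real.pi, g (circleMap w ρ θ) := by
  have hsymm : ∀ p : ℝ × ℝ, w + Complex.polarCoord.symm p = circleMap w p.1 p.2 := by
    intro p
    simp [circleMap, Complex.exp_mul_I]
  have hcm : Measurable fun p : ℝ × ℝ => circleMap w p.1 p.2 := by
    unfold circleMap; fun_prop
  have hind : Measurable ((Metric.ball w r).indicator g) :=
    hg.indicator Metric.isOpen_ball.measurableSet
  rw [← lintegral_indicator Metric.isOpen_ball.measurableSet,
    ← lintegral_add_left_eq_self _ w, ← Complex.lintegral_comp_polarCoord_symm]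
  simp only [hsymm, polarCoord_target, smul_eq_mul]
  rw [Measure.volume_eq_prod, ← Measure.prod_restrict, lintegral_prod]
  · rw [← lintegral_indicator measurableSet_Ioi, ← lintegral_indicator measurableSet_Ioo]
    refine lintegral_congr fun ρ => ?_
    by_cases h0 : 0 < ρ
    · rw [Set.indicator_of_mem (Set.mem_Ioi.2 h0)]
      have hcr : Measurable fun θ => circleMap w ρ θ := (continuous_circleMap w ρ).measurable
      have hmul := lintegral_const_mul (μ := volume.restrict (Set.Ioo (-Real.pi) Real.pi))
        (ENNReal.ofReal ρ) (hind.comp hcr)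
      simp only [Function.comp_apply] at hmul
      rw [hmul]
      by_cases hr : ρ < r
      · rw [Set.indicator_of_mem (Set.mem_Ioo.2 ⟨h0, hr⟩)]
        congr 1
        refine lintegral_congr fun θ => Set.indicator_of_mem ?_ _
        simp [dist_eq_norm, circleMap, abs_of_pos h0, hr]
      · rw [Set.indicator_of_notMem (fun h => hr h.2)]
        have : ∀ θ, (Metric.ball w r).indicator g (circleMap w ρ θ) = 0 := fun θ =>
          Set.indicator_of_notMem (by simpa [dist_eq_norm, circleMap, abs_of_pos h0] using hr) _
        simp [this]
    · rw [Set.indicator_of_notMem (by simpa using h0),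
        Set.indicator_of_notMem (fun h => h0 h.1)]
  · exact ((measurable_fst.ennreal_ofReal).mul (hind.comp hcm)).aemeasurable

/-- The area form of the mean value inequality for holomorphic functions. -/
theorem enorm_mul_volume_ball_le {h : ℂ → ℂ} {w : ℂ} {r : ℝ}
    (hh : DifferentiableOn ℂ h (Metric.ball w r)) :
    ‖h w‖ₑ * volume (Metric.ball w r) ≤ ∫⁻ u in Metric.ball w r, ‖h u‖ₑ := by
  classical
  -- The polar formula needs a function measurable on all of ℂ, while h is controlled on the disc
  -- only; hence the cut-off.
  set H : ℂ → ℂ := (Metric.ball w r).piecewise h 0 with hH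
  have hHm : Measurable H :=
    ContinuousOn.measurable_piecewise hh.continuousOn continuousOn_const
      Metric.isOpen_ball.measurableSet
  have hHe : Set.EqOn H h (Metric.ball w r) := fun u hu => by simp [hH, hu]
  have h1 : ∫⁻ u in Metric.ball w r, ‖h u‖ₑ = ∫⁻ u in Metric.ball w r, ‖H u‖ₑ :=
    setLIntegral_congr_fun Metric.isOpen_ball.measurableSet fun u hu => by rw [hHe hu]
  rw [h1, lintegral_ball_eq_polar hHm.enorm, ← setLIntegral_const,
    lintegral_ball_eq_polar measurable_const]
  refine setLIntegral_mono' measurableSet_Ioo fun ρ hρ => ?_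
  gcongr ENNReal.ofReal ρ * ?_
  have hsub : Metric.closedBall w ρ ⊆ Metric.ball w r := Metric.closedBall_subset_ball hρ.2
  have hd : DiffContOnCl ℂ h (Metric.ball w |ρ|) := by
    rw [abs_of_pos hρ.1]
    exact DifferentiableOn.diffContOnCl (hh.mono (by rwa [closure_ball _ hρ.1.ne']))
  have hmv := hd.circleAverage
  -- The circle average is moved to the angles (-π, π) used by polar coordinates.
  rw [Real.circleAverage_eq_integral_add (-Real.pi), intervalIntegral.integral_comp_add_right
    (fun θ => h (circleMap w ρ θ)), zero_add, show 2 * Real.pi + -Real.pi = Real.pi by ring,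
    intervalIntegral.integral_of_le (by linarith [Real.pi_pos]),
    integral_Ioc_eq_integral_Ioo] at hmv
  have hpi : (0 : ℝ) < 2 * Real.pi := by positivity
  have hint : ∫ θ in Set.Ioo (-Real.pi) Real.pi, h (circleMap w ρ θ) = (2 * Real.pi) • h w := by
    rw [← hmv, smul_smul, mul_inv_cancel₀ hpi.ne', one_smul]
  have hmem : ∀ θ, H (circleMap w ρ θ) = h (circleMap w ρ θ) := fun θ =>
    hHe (hsub (circleMap_mem_closedBall w hρ.1.le θ))
  simp only [hmem]
  refine le_trans (le_of_eq ?_) (enorm_integral_le_lintegral_enorm _)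
  rw [hint, enorm_smul, setLIntegral_const, Real.volume_Ioo, mul_comm, Real.enorm_eq_ofReal hpi.le]
  congr 2
  ring

/-! ### Integrals of the weight over boxes and discs -/

theorem lintegral_complex_eq_prod (g : ℂ → ℝ≥0∞) :
    ∫⁻ z, g z = ∫⁻ p : ℝ × ℝ, g (p.1 + p.2 * Complex.I) := by
  rw [← (Complex.volume_preserving_equiv_real_prod.symm).lintegral_comp_emb
    Complex.measurableEquivRealProd.symm.measurableEmbedding]
  refine lintegral_congr fun p => ?_
  congr 1
  apply Complex.ext <;> simp [Complex.measurableEquivRealProd]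

theorem lintegral_rpow_Ioo_zero {α : ℝ} (hα : -1 < α) {c : ℝ} (hc : 0 < c) :
    ∫⁻ x in Set.Ioo 0 c, ENNReal.ofReal (x ^ α) = ENNReal.ofReal (c ^ (α + 1) / (α + 1)) := by
  have hi : IntegrableOn (fun x : ℝ => x ^ α) (Set.Ioo 0 c) :=
    (intervalIntegral.integrableOn_Ioo_rpow_iff hc).2 hα
  rw [← ofReal_integral_eq_lintegral_ofReal hi]
  · rw [← integral_Ioc_eq_integral_Ioo, ← intervalIntegral.integral_of_le hc.le,
      integral_rpow (Or.inl hα), Real.zero_rpow (by linarith), sub_zero]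
  · filter_upwards [ae_restrict_mem measurableSet_Ioo] with x hx
    exact (Real.rpow_pos_of_pos hx.1 α).le

/-- The product set `{0 < Re z < c, p < Im z < q}` has finite weighted measure. -/
theorem lintegral_rpow_re_box {α : ℝ} (hα : -1 < α) {c : ℝ} (hc : 0 < c) (p q : ℝ) :
    ∫⁻ z in {z : ℂ | z.re ∈ Set.Ioo 0 c ∧ z.im ∈ Set.Ioo p q}, ENNReal.ofReal (z.re ^ α) =
      ENNReal.ofReal (c ^ (α + 1) / (α + 1)) * ENNReal.ofReal (q - p) := by
  have hm : MeasurableSet {z : ℂ | z.re ∈ Set.Ioo 0 c ∧ z.im ∈ Set.Ioo p q} :=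
    (Complex.measurable_re measurableSet_Ioo).inter (Complex.measurable_im measurableSet_Ioo)
  rw [← lintegral_indicator hm, lintegral_complex_eq_prod, ← lintegral_rpow_Ioo_zero hα hc,
    ← lintegral_indicator measurableSet_Ioo, ← Real.volume_Ioo,
    ← lintegral_indicator_one measurableSet_Ioo, Measure.volume_eq_prod,
    ← lintegral_prod_mul]
  · refine lintegral_congr fun x => ?_
    have hre : ((x.1 : ℂ) + x.2 * Complex.I).re = x.1 := by simp
    have him : ((x.1 : ℂ) + x.2 * Complex.I).im = x.2 := by simp
    simp only [Set.indicator_apply, Set.mem_ofPred_eq, hre, him]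
    by_cases h1 : x.1 ∈ Set.Ioo 0 c <;> by_cases h2 : x.2 ∈ Set.Ioo p q <;>
      simp only [h1, h2, and_self, and_true, and_false, if_true, if_false, Pi.one_apply,
        mul_one, mul_zero]
  · exact (((measurable_id.pow_const α).ennreal_ofReal).indicator measurableSet_Ioo).aemeasurable
  · exact (measurable_one.indicator measurableSet_Ioo).aemeasurable

/-- The constant bounding the norms of translations. -/
noncomputable def translationConst (α : ℝ) : ℝ :=
  1 + (2⁻¹ : ℝ) ^ α + 12 / (α + 1)

theorem one_le_translationConst {α : ℝ} (hα : -1 < α) : 1 ≤ translationConst α := by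
  have h1 : 0 < (2⁻¹ : ℝ) ^ α := Real.rpow_pos_of_pos (by norm_num) α
  have h2 : 0 < 12 / (α + 1) := div_pos (by norm_num) (by linarith)
  unfold translationConst
  linarith

/-- The three summands of `translationConst` serve three cases. If α ≥ 0, then Re w ≤ Re u on the
disc. If α < 0 and Re u ≥ 3 Re b, then Re w ≥ Re u / 2. Otherwise the disc may reach the boundary,
where the weight blows up, but integrability (α > -1) bounds its mass. The constant does not involve
b. -/
theorem lintegral_rpow_re_ball_le {α : ℝ} (hα : -1 < α) {b u : ℂ} (hb : 0 < b.re)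
    (hu : 0 < u.re) :
    ∫⁻ w in rightHalfPlaneSet ∩ Metric.ball (u - b) (b.re / 2), ENNReal.ofReal (w.re ^ α) ≤
      ENNReal.ofReal (translationConst α * u.re ^ α) *
        volume (Metric.ball (0 : ℂ) (b.re / 2)) := by
  have h1 : 0 < (2⁻¹ : ℝ) ^ α := Real.rpow_pos_of_pos (by norm_num) α
  have h2 : 0 < 12 / (α + 1) := div_pos (by norm_num) (by linarith)
  have hua : 0 < u.re ^ α := Real.rpow_pos_of_pos hu α
  have hms : MeasurableSet (rightHalfPlaneSet ∩ Metric.ball (u - b) (b.re / 2)) :=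
    (isOpen_rightHalfPlaneSet.inter Metric.isOpen_ball).measurableSet
  have hball : ∀ w ∈ rightHalfPlaneSet ∩ Metric.ball (u - b) (b.re / 2),
      0 < w.re ∧ |w.re - (u.re - b.re)| < b.re / 2 ∧ |w.im - (u.im - b.im)| < b.re / 2 := by
    rintro w ⟨hw, hw'⟩
    rw [Metric.mem_ball, dist_eq_norm] at hw'
    refine ⟨hw, ?_, ?_⟩
    · simpa using (Complex.abs_re_le_norm _).trans_lt hw'
    · simpa using (Complex.abs_im_le_norm _).trans_lt hw'
  -- a pointwise bound on the density suffices
  have key : ∀ M : ℝ, M ≤ translationConst α →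
      (∀ w ∈ rightHalfPlaneSet ∩ Metric.ball (u - b) (b.re / 2), w.re ^ α ≤ M * u.re ^ α) →
      ∫⁻ w in rightHalfPlaneSet ∩ Metric.ball (u - b) (b.re / 2), ENNReal.ofReal (w.re ^ α) ≤
      ENNReal.ofReal (translationConst α * u.re ^ α) *
        volume (Metric.ball (0 : ℂ) (b.re / 2)) := by
    intro M hM h
    calc _ ≤ ∫⁻ w in rightHalfPlaneSet ∩ Metric.ball (u - b) (b.re / 2),
          ENNReal.ofReal (translationConst α * u.re ^ α) :=
          setLIntegral_mono' hms fun w hw => ENNReal.ofReal_le_ofReal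
            ((h w hw).trans (by gcongr))
      _ ≤ _ := by
          rw [setLIntegral_const]
          gcongr _ * ?_
          rw [← Measure.addHaar_ball_center volume (u - b)]
          exact measure_mono Set.inter_subset_right
  rcases le_or_gt 0 α with h0 | h0
  · refine key 1 (one_le_translationConst hα) fun w hw => ?_
    obtain ⟨hw0, hw1, -⟩ := hball w hw
    rw [abs_lt] at hw1
    rw [one_mul]
    exact Real.rpow_le_rpow hw0.le (by linarith) h0
  rcases le_or_gt (3 * b.re) u.re with h3 | h3
  · refine key ((2⁻¹ : ℝ) ^ α) (by unfold translationConst; linarith) fun w hw => ?_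
    obtain ⟨hw0, hw1, -⟩ := hball w hw
    rw [abs_lt] at hw1
    rw [← Real.mul_rpow (by norm_num) hu.le]
    exact Real.rpow_le_rpow_of_nonpos (by positivity) (by linarith) h0.le
  · have hbox : rightHalfPlaneSet ∩ Metric.ball (u - b) (b.re / 2) ⊆
        {z : ℂ | z.re ∈ Set.Ioo 0 (3 * b.re) ∧
          z.im ∈ Set.Ioo (u.im - b.im - b.re / 2) (u.im - b.im + b.re / 2)} := by
      intro w hw
      obtain ⟨hw0, hw1, hw2⟩ := hball w hw
      rw [abs_lt] at hw1 hw2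
      refine ⟨⟨hw0, by linarith⟩, ⟨by linarith, by linarith⟩⟩
    have h3b : 0 < 3 * b.re := by linarith
    refine (lintegral_mono_set hbox).trans ?_
    rw [lintegral_rpow_re_box hα h3b, Complex.volume_ball,
      ← ENNReal.ofReal_pow (by positivity),
      ← ENNReal.ofReal_mul (div_nonneg (Real.rpow_nonneg h3b.le _) (by linarith))]
    -- The crude bound π ≥ 3 keeps π out of the comparison of the box with the disc.
    have hpi : ENNReal.ofReal 3 ≤ (NNReal.pi : ℝ≥0∞) := by
      rw [← ENNReal.ofReal_coe_nnreal]
      exact ENNReal.ofReal_le_ofReal Real.pi_gt_three.le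
    have hKu : 0 ≤ translationConst α * u.re ^ α :=
      mul_nonneg (by linarith [one_le_translationConst hα]) hua.le
    refine le_trans ?_ (mul_le_mul_right (mul_le_mul_right hpi _) _)
    rw [← ENNReal.ofReal_mul (by positivity), ← ENNReal.ofReal_mul hKu]
    refine ENNReal.ofReal_le_ofReal ?_
    have h4 : (3 * b.re) ^ α ≤ u.re ^ α := Real.rpow_le_rpow_of_nonpos hu h3.le h0.le
    have h5 : 12 / (α + 1) ≤ translationConst α := by unfold translationConst; linarith
    rw [Real.rpow_add_one h3b.ne']
    calc (3 * b.re) ^ α * (3 * b.re) / (α + 1) *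
          (u.im - b.im + b.re / 2 - (u.im - b.im - b.re / 2))
        = (3 * b.re) ^ α * (3 * b.re ^ 2 / (α + 1)) := by ring
      _ ≤ u.re ^ α * (3 * b.re ^ 2 / (α + 1)) := by
          have : 0 < α + 1 := by linarith
          gcongr
      _ ≤ u.re ^ α * (translationConst α * ((b.re / 2) ^ 2 * 3)) := by
          gcongr
          calc 3 * b.re ^ 2 / (α + 1) ≤ 12 / (α + 1) * ((b.re / 2) ^ 2 * 3) := by
                have : 0 < α + 1 := by linarith
                rw [div_mul_eq_mul_div]
                refine div_le_div_of_nonneg_right ?_ this.le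
                nlinarith [sq_nonneg b.re]
            _ ≤ _ := by gcongr
      _ = _ := by ring

/-! ### Energy under affine substitutions -/

/-- The squared weighted norm `∫∫ |F(x + i y)|² x^α dx dy` over the right half-plane. -/
noncomputable def bergmanEnergy (α : ℝ) (F : ℂ → ℂ) : ℝ≥0∞ :=
  ∫⁻ z in rightHalfPlaneSet, ENNReal.ofReal (z.re ^ α) * ‖F z‖ₑ ^ 2

theorem bergmanEnergy_congr {α : ℝ} {F G : ℂ → ℂ} (h : Set.EqOn F G rightHalfPlaneSet) :
    bergmanEnergy α F = bergmanEnergy α G :=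
  setLIntegral_congr_fun isOpen_rightHalfPlaneSet.measurableSet fun z hz => by simp only [h hz]

/-- The weight contributes a^(-α) and the planar Jacobian a^(-2). -/
theorem bergmanEnergy_comp_mul {α a : ℝ} (ha : 0 < a) (F : ℂ → ℂ) :
    bergmanEnergy α (fun w => F (a * w)) = ENNReal.ofReal (a ^ (-(α + 2))) * bergmanEnergy α F := by
  have hS := isOpen_rightHalfPlaneSet.measurableSet
  unfold bergmanEnergy
  rw [← lintegral_indicator hS, ← lintegral_indicator hS]
  set H : ℂ → ℝ≥0∞ :=
    rightHalfPlaneSet.indicator fun z => ENNReal.ofReal (z.re ^ α) * ‖F z‖ₑ ^ 2 with hH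
  have h1 : ∀ w : ℂ, rightHalfPlaneSet.indicator
      (fun z => ENNReal.ofReal (z.re ^ α) * ‖F (a * z)‖ₑ ^ 2) w =
      ENNReal.ofReal (a ^ (-α)) * H (a • w) := by
    intro w
    by_cases hw : 0 < w.re
    · have hw' : 0 < (a • w).re := by simpa using mul_pos ha hw
      rw [hH, Set.indicator_of_mem (show w ∈ rightHalfPlaneSet from hw),
        Set.indicator_of_mem (show a • w ∈ rightHalfPlaneSet from hw'), ← mul_assoc,
        ← ENNReal.ofReal_mul (Real.rpow_nonneg ha.le _), Complex.real_smul]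
      congr 2
      rw [← Complex.real_smul, Complex.smul_re, smul_eq_mul, Real.mul_rpow ha.le hw.le,
        ← mul_assoc, ← Real.rpow_add ha, neg_add_cancel, Real.rpow_zero, one_mul]
    · have hw' : ¬ 0 < (a • w).re := by
        simpa using mul_nonpos_of_nonneg_of_nonpos ha.le (not_lt.1 hw)
      rw [hH, Set.indicator_of_notMem (show w ∉ rightHalfPlaneSet from hw),
        Set.indicator_of_notMem (show a • w ∉ rightHalfPlaneSet from hw'), mul_zero]
  have h2 : ∫⁻ w : ℂ, H (a • w) = ENNReal.ofReal (a ^ (-2 : ℝ)) * ∫⁻ w, H w := by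
    rw [← (measurableEmbedding_const_smul₀ ha.ne').lintegral_map (μ := volume) H,
      Measure.map_addHaar_smul _ ha.ne', lintegral_smul_measure, Complex.finrank_real_complex,
      abs_of_nonneg (by positivity), smul_eq_mul, Real.rpow_neg ha.le, Real.rpow_ofNat]
  simp only [h1]
  rw [lintegral_const_mul' _ _ ENNReal.ofReal_ne_top, h2, ← mul_assoc,
    ← ENNReal.ofReal_mul (Real.rpow_nonneg ha.le _), ← Real.rpow_add ha]
  ring_nf

theorem bergmanEnergy_comp_add_of_re_eq_zero {α : ℝ} {b : ℂ} (hb : b.re = 0) (F : ℂ → ℂ) :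
    bergmanEnergy α (fun w => F (w + b)) = bergmanEnergy α F := by
  have hS := isOpen_rightHalfPlaneSet.measurableSet
  unfold bergmanEnergy
  rw [← lintegral_indicator hS, ← lintegral_indicator hS,
    ← lintegral_add_right_eq_self
      (rightHalfPlaneSet.indicator fun z => ENNReal.ofReal (z.re ^ α) * ‖F z‖ₑ ^ 2) b]
  refine lintegral_congr fun w => ?_
  have : (w + b).re = w.re := by simp [hb]
  simp only [Set.indicator_apply, rightHalfPlaneSet, Set.mem_ofPred_eq, this]

/-- Bound |F(w + b)|² by the mean of |F|² over a disc about w + b, integrate against the weight in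
w, and exchange the integrals: each |F(u)|² is then multiplied by the weighted mass of a disc about
u - b, which is comparable to (Re u)^α. -/
theorem bergmanEnergy_comp_add_le_of_re_pos {α : ℝ} (hα : -1 < α) {b : ℂ} (hb : 0 < b.re)
    {F : ℂ → ℂ} (hF : DifferentiableOn ℂ F rightHalfPlaneSet) :
    bergmanEnergy α (fun w => F (w + b)) ≤
      ENNReal.ofReal (translationConst α) * bergmanEnergy α F := by
  classical
  have hS := isOpen_rightHalfPlaneSet.measurableSet
  set r := b.re / 2 with hr
  have hr0 : 0 < r := by positivity
  set V := volume (Metric.ball (0 : ℂ) r) with hV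
  have hV0 : V ≠ 0 := (Metric.measure_ball_pos _ _ hr0).ne'
  have hVt : V ≠ ∞ := measure_ball_lt_top.ne
  set g : ℂ → ℝ≥0∞ := fun u => ‖rightHalfPlaneSet.piecewise F 0 u‖ₑ ^ 2 with hg
  have hgm : Measurable g :=
    (ContinuousOn.measurable_piecewise hF.continuousOn continuousOn_const hS).enorm.pow_const 2
  have hgS : ∀ u ∈ rightHalfPlaneSet, g u = ‖F u‖ₑ ^ 2 := fun u hu => by simp [hg, hu]
  set D : Set (ℂ × ℂ) := {p | p.1 ∈ rightHalfPlaneSet ∧ dist p.2 (p.1 + b) < r} with hD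
  have hDm : MeasurableSet D := by
    have hdist : Continuous fun p : ℂ × ℂ => dist p.2 (p.1 + b) := by fun_prop
    exact ((isOpen_rightHalfPlaneSet.preimage continuous_fst).inter
      (isOpen_lt hdist continuous_const)).measurableSet
  set k : ℂ × ℂ → ℝ≥0∞ := D.indicator fun p => ENNReal.ofReal (p.1.re ^ α) * g p.2 with hk
  have hkm : Measurable k :=
    (((measurable_rpow_re α).comp measurable_fst).mul (hgm.comp measurable_snd)).indicator hDm
  -- The radius Re b / 2 is less than Re (w + b), so the disc stays in the half-plane.
  have hmem : ∀ w u, w ∈ rightHalfPlaneSet → dist u (w + b) < r → u ∈ rightHalfPlaneSet := by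
    intro w u (hw : 0 < w.re) hu
    rw [dist_eq_norm] at hu
    have := (Complex.abs_re_le_norm _).trans_lt hu
    rw [abs_lt] at this
    simp only [Complex.sub_re, Complex.add_re] at this
    change 0 < u.re
    linarith [this.1]
  have h1 : bergmanEnergy α (fun w => F (w + b)) * V ≤ ∫⁻ w, ∫⁻ u, k (w, u) := by
    unfold bergmanEnergy
    rw [← lintegral_mul_const' _ _ hVt, ← lintegral_indicator hS]
    refine lintegral_mono fun w => ?_
    by_cases hw : w ∈ rightHalfPlaneSet
    · rw [Set.indicator_of_mem hw, mul_assoc]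
      have hsub : Metric.ball (w + b) r ⊆ rightHalfPlaneSet := fun u hu => hmem w u hw hu
      have hmv := enorm_mul_volume_ball_le (h := fun u => F u ^ 2) ((hF.mono hsub).pow 2)
      simp only [enorm_pow] at hmv
      rw [Measure.addHaar_ball_center volume (w + b)] at hmv
      have hkw : ∀ u, k (w, u) = ENNReal.ofReal (w.re ^ α) *
          (Metric.ball (w + b) r).indicator (fun u => ‖F u‖ₑ ^ 2) u := by
        intro u
        by_cases hu : u ∈ Metric.ball (w + b) r
        · rw [hk, Set.indicator_of_mem (show (w, u) ∈ D from ⟨hw, hu⟩), Set.indicator_of_mem hu,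
            hgS u (hsub hu)]
        · rw [hk, Set.indicator_of_notMem (show (w, u) ∉ D from fun h => hu h.2),
            Set.indicator_of_notMem hu, mul_zero]
      simp only [hkw]
      rw [lintegral_const_mul' _ _ ENNReal.ofReal_ne_top,
        lintegral_indicator Metric.isOpen_ball.measurableSet]
      gcongr
    · rw [Set.indicator_of_notMem hw]
      exact zero_le
  have h2 : ∫⁻ w, ∫⁻ u, k (w, u) ≤
      ENNReal.ofReal (translationConst α) * V * bergmanEnergy α F := by
    rw [lintegral_lintegral_swap (f := fun w u => k (w, u)) hkm.aemeasurable]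
    unfold bergmanEnergy
    rw [← lintegral_const_mul' _ _ (ENNReal.mul_ne_top ENNReal.ofReal_ne_top hVt),
      ← lintegral_indicator hS]
    refine lintegral_mono fun u => ?_
    by_cases hu : u ∈ rightHalfPlaneSet
    · rw [Set.indicator_of_mem hu]
      have hku : ∀ w, k (w, u) = (rightHalfPlaneSet ∩ Metric.ball (u - b) r).indicator
          (fun w => ENNReal.ofReal (w.re ^ α)) w * g u := by
        intro w
        have hiff : (w, u) ∈ D ↔ w ∈ rightHalfPlaneSet ∩ Metric.ball (u - b) r := by
          simp only [hD, Set.mem_ofPred_eq, Set.mem_inter_iff, Metric.mem_ball]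
          rw [dist_comm w, dist_eq_norm, dist_eq_norm, sub_sub, add_comm b]
        by_cases hw : w ∈ rightHalfPlaneSet ∩ Metric.ball (u - b) r
        · rw [hk, Set.indicator_of_mem (hiff.2 hw), Set.indicator_of_mem hw]
        · rw [hk, Set.indicator_of_notMem (fun h => hw (hiff.1 h)), Set.indicator_of_notMem hw,
            zero_mul]
      simp only [hku]
      rw [lintegral_mul_const _ ((measurable_rpow_re α).indicator
        (isOpen_rightHalfPlaneSet.inter Metric.isOpen_ball).measurableSet),
        lintegral_indicator (isOpen_rightHalfPlaneSet.inter Metric.isOpen_ball).measurableSet,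
        hgS u hu]
      refine (mul_le_mul_left (lintegral_rpow_re_ball_le hα hb hu) _).trans (le_of_eq ?_)
      rw [ENNReal.ofReal_mul (by linarith [one_le_translationConst hα])]
      ring
    · have hz : ∀ w, k (w, u) = 0 := fun w =>
        Set.indicator_of_notMem (fun h => hu (hmem w u h.1 h.2)) _
      simp [hz]
  have h3 := h1.trans h2
  rw [mul_right_comm] at h3
  exact (ENNReal.mul_le_mul_iff_left hV0 hVt).1 h3

theorem bergmanEnergy_comp_affine_le {α : ℝ} (hα : -1 < α) {a : ℝ} (ha : 0 < a) {b : ℂ}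
    (hb : 0 ≤ b.re) {F : ℂ → ℂ} (hF : DifferentiableOn ℂ F rightHalfPlaneSet) :
    bergmanEnergy α (fun w => F (a * w + b)) ≤
      ENNReal.ofReal (translationConst α * a ^ (-(α + 2))) * bergmanEnergy α F := by
  have hK := one_le_translationConst hα
  have h : bergmanEnergy α (fun w => F (w + b)) ≤
      ENNReal.ofReal (translationConst α) * bergmanEnergy α F := by
    rcases hb.eq_or_lt with h0 | h0
    · rw [bergmanEnergy_comp_add_of_re_eq_zero h0.symm]
      exact le_mul_of_one_le_left zero_le (ENNReal.one_le_ofReal.2 hK)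
    · exact bergmanEnergy_comp_add_le_of_re_pos hα h0 hF
  rw [bergmanEnergy_comp_mul ha (fun w => F (w + b)), mul_comm (translationConst α),
    ENNReal.ofReal_mul (Real.rpow_nonneg ha.le _), mul_assoc]
  gcongr

/-! ### Norm and energy, point evaluations, completeness -/

theorem lintegral_bergmanMeasure (α : ℝ) (g : ℂ → ℝ≥0∞) :
    ∫⁻ z, g z ∂bergmanMeasure α =
      ENNReal.ofReal (1 / Real.pi) *
        ∫⁻ z in rightHalfPlaneSet, ENNReal.ofReal (z.re ^ α) * g z := by
  unfold bergmanMeasure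
  rw [lintegral_smul_measure, lintegral_withDensity_eq_lintegral_mul_non_measurable _
    (measurable_rpow_re α) (Filter.Eventually.of_forall fun _ => ENNReal.ofReal_lt_top)]
  rfl

theorem bergmanMeasure_absolutelyContinuous (α : ℝ) :
    bergmanMeasure α ≪ volume.restrict rightHalfPlaneSet :=
  Measure.AbsolutelyContinuous.smul_left (withDensity_absolutelyContinuous _ _) _

theorem eLpNorm_bergmanMeasure_sq (α : ℝ) (F : ℂ → ℂ) :
    eLpNorm F 2 (bergmanMeasure α) ^ 2 = ENNReal.ofReal (1 / Real.pi) * bergmanEnergy α F := by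
  have := eLpNorm_nnreal_pow_eq_lintegral (f := F) (μ := bergmanMeasure α) (p := 2) (by norm_num)
  simp only [ENNReal.coe_ofNat, NNReal.coe_ofNat, ENNReal.rpow_ofNat] at this
  rw [this, lintegral_bergmanMeasure, bergmanEnergy]

theorem memLp_of_bergmanEnergy_lt_top {α : ℝ} {F : ℂ → ℂ}
    (hF : DifferentiableOn ℂ F rightHalfPlaneSet) (h : bergmanEnergy α F < ∞) :
    MemLp F 2 (bergmanMeasure α) := by
  refine ⟨(hF.continuousOn.aestronglyMeasurable
    isOpen_rightHalfPlaneSet.measurableSet).mono_ac (bergmanMeasure_absolutelyContinuous α), ?_⟩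
  have h2 : eLpNorm F 2 (bergmanMeasure α) ^ 2 < ∞ := by
    rw [eLpNorm_bergmanMeasure_sq]
    exact ENNReal.mul_lt_top ENNReal.ofReal_lt_top h
  simpa using h2

theorem zeroExt_eqOn (F : ℂ → ℂ) :
    Set.EqOn (zeroExt fun w => F w) F rightHalfPlaneSet := fun z hz =>
  zeroExt_apply _ ⟨z, hz⟩

theorem zeroExt_apply_of_pos (f : RightHalfPlane → ℂ) {z : ℂ} (hz : 0 < z.re) :
    zeroExt f z = f ⟨z, hz⟩ :=
  zeroExt_apply f ⟨z, hz⟩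

namespace WeightedBergman

variable {α : ℝ}

theorem differentiableOn (f : WeightedBergman α) :
    DifferentiableOn ℂ (zeroExt f) rightHalfPlaneSet := f.2.1

/-- The element of the Bergman space given by a holomorphic function of finite energy. -/
noncomputable def mk (F : ℂ → ℂ) (hF : DifferentiableOn ℂ F rightHalfPlaneSet)
    (h : bergmanEnergy α F < ∞) : WeightedBergman α :=
  ⟨fun w => F w, hF.congr (zeroExt_eqOn F), memLp_of_bergmanEnergy_lt_top
    (hF.congr (zeroExt_eqOn F)) (by rwa [bergmanEnergy_congr (zeroExt_eqOn F)])⟩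

@[simp] theorem mk_apply (F : ℂ → ℂ) (hF : DifferentiableOn ℂ F rightHalfPlaneSet)
    (h : bergmanEnergy α F < ∞) (w : RightHalfPlane) : mk F hF h w = F w := rfl

@[simp] theorem add_apply (f g : WeightedBergman α) (w : RightHalfPlane) :
    (f + g) w = f w + g w := rfl

@[simp] theorem smul_apply (c : ℂ) (f : WeightedBergman α) (w : RightHalfPlane) :
    (c • f) w = c * f w := rfl

theorem enorm_sq_eq (f : WeightedBergman α) :
    ‖f‖ₑ ^ 2 = ENNReal.ofReal (1 / Real.pi) * bergmanEnergy α (zeroExt f) := by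
  rw [← eLpNorm_bergmanMeasure_sq, ← Lp.enorm_toLp f.memLp]
  rfl

theorem bergmanEnergy_lt_top (f : WeightedBergman α) : bergmanEnergy α (zeroExt f) < ∞ := by
  have h := enorm_sq_eq f
  by_contra h2
  rw [not_lt, top_le_iff] at h2
  have hpi : ENNReal.ofReal (1 / Real.pi) ≠ 0 := by simp [Real.pi_pos]
  rw [h2, ENNReal.mul_top hpi] at h
  exact ENNReal.pow_ne_top enorm_ne_top h

theorem norm_le_of_enorm_sq_le {E F : Type*} [SeminormedAddCommGroup E] [SeminormedAddCommGroup F]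
    {x : E} {y : F} {c : ℝ} (hc : 0 ≤ c) (h : ‖x‖ₑ ^ 2 ≤ ENNReal.ofReal (c ^ 2) * ‖y‖ₑ ^ 2) :
    ‖x‖ ≤ c * ‖y‖ := by
  rw [← ofReal_norm, ← ofReal_norm, ← ENNReal.ofReal_pow (norm_nonneg _),
    ← ENNReal.ofReal_pow (norm_nonneg _), ← ENNReal.ofReal_mul (sq_nonneg c), ← mul_pow,
    ENNReal.ofReal_le_ofReal_iff (sq_nonneg _)] at h
  exact (pow_le_pow_iff_left₀ (norm_nonneg _) (by positivity) two_ne_zero).1 h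

/-- Point evaluations are bounded, locally uniformly in the point. -/
theorem exists_norm_zeroExt_le (α : ℝ) {w : ℂ} (hw : 0 < w.re) :
    ∃ C : ℝ, 0 ≤ C ∧ ∀ f : WeightedBergman α, ∀ z ∈ Metric.ball w (w.re / 4),
      ‖zeroExt f z‖ ≤ C * ‖f‖ := by
  -- Discs of radius r about points of `ball w r` lie in `ball w (2 * r)`, where the real part is
  -- between 2r and 6r and the weight has a positive lower bound.
  set r := w.re / 4 with hr
  have hr0 : 0 < r := by positivity
  obtain ⟨v, hv⟩ : ∃ v : ℝ, v = (volume (Metric.ball (0 : ℂ) r)).toReal := ⟨_, rfl⟩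
  have hv0 : 0 < v := by
    rw [hv]
    exact ENNReal.toReal_pos (Metric.measure_ball_pos _ _ hr0).ne' measure_ball_lt_top.ne
  have hvV : volume (Metric.ball (0 : ℂ) r) = ENNReal.ofReal v := by
    rw [hv, ENNReal.ofReal_toReal measure_ball_lt_top.ne]
  have hre : ∀ u ∈ Metric.ball w (2 * r), 2 * r ≤ u.re ∧ u.re ≤ 6 * r := by
    intro u hu
    rw [Metric.mem_ball, dist_eq_norm] at hu
    have := (Complex.abs_re_le_norm _).trans_lt hu
    rw [abs_lt] at this
    simp only [Complex.sub_re] at this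
    constructor <;> linarith [this.1, this.2]
  obtain ⟨m, hm0, hm⟩ : ∃ m : ℝ, 0 < m ∧ ∀ u ∈ Metric.ball w (2 * r), m ≤ u.re ^ α := by
    refine ⟨min ((2 * r) ^ α) ((6 * r) ^ α), lt_min (by positivity) (by positivity), ?_⟩
    intro u hu
    obtain ⟨h1, h2⟩ := hre u hu
    rcases le_total 0 α with h0 | h0
    · exact (min_le_left _ _).trans (Real.rpow_le_rpow (by positivity) h1 h0)
    · exact (min_le_right _ _).trans
        (Real.rpow_le_rpow_of_nonpos (lt_of_lt_of_le (by positivity) h1) h2 h0)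
  refine ⟨√(Real.pi / (m * v)), Real.sqrt_nonneg _, fun f z hz => ?_⟩
  apply norm_le_of_enorm_sq_le (Real.sqrt_nonneg _)
  rw [Real.sq_sqrt (by positivity), enorm_sq_eq, ← mul_assoc,
    ← ENNReal.ofReal_mul (by positivity)]
  have hsub : Metric.ball z r ⊆ Metric.ball w (2 * r) :=
    Metric.ball_subset_ball' (by linarith [Metric.mem_ball.1 hz])
  have hsubS : Metric.ball w (2 * r) ⊆ rightHalfPlaneSet := fun u hu =>
    lt_of_lt_of_le (by positivity) (hre u hu).1
  have hmv := enorm_mul_volume_ball_le (h := fun u => zeroExt f u ^ 2)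
    ((f.differentiableOn.mono (hsub.trans hsubS)).pow 2)
  simp only [enorm_pow] at hmv
  rw [Measure.addHaar_ball_center volume z, hvV] at hmv
  have h1 : ENNReal.ofReal m * ∫⁻ u in Metric.ball z r, ‖zeroExt f u‖ₑ ^ 2 ≤
      bergmanEnergy α (zeroExt f) := by
    rw [← lintegral_const_mul' _ _ ENNReal.ofReal_ne_top]
    refine le_trans (setLIntegral_mono' Metric.isOpen_ball.measurableSet fun u hu => ?_)
      (lintegral_mono_set (hsub.trans hsubS))
    gcongr
    exact hm u (hsub hu)
  have h2 : ENNReal.ofReal (m * v) * ‖zeroExt f z‖ₑ ^ 2 ≤ bergmanEnergy α (zeroExt f) := by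
    rw [ENNReal.ofReal_mul hm0.le, mul_assoc, mul_comm (ENNReal.ofReal v)]
    exact le_trans (by gcongr) h1
  calc ‖zeroExt f z‖ₑ ^ 2
      = ENNReal.ofReal (1 / (m * v)) * (ENNReal.ofReal (m * v) * ‖zeroExt f z‖ₑ ^ 2) := by
        rw [← mul_assoc, ← ENNReal.ofReal_mul (by positivity),
          one_div_mul_cancel (by positivity), ENNReal.ofReal_one, one_mul]
    _ ≤ ENNReal.ofReal (1 / (m * v)) * bergmanEnergy α (zeroExt f) := by gcongr
    _ = _ := by
        congr 2
        field_simp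

theorem zeroExt_sub (f g : WeightedBergman α) (z : ℂ) :
    zeroExt (f - g : WeightedBergman α) z = zeroExt f z - zeroExt g z := by
  by_cases hz : 0 < z.re
  · simp only [zeroExt_apply_of_pos _ hz]; rfl
  · simp [zeroExt_of_notMem _ hz]

/-- Bounded point evaluations make a Cauchy sequence converge locally uniformly, hence to a
holomorphic function. A subsequence converges almost everywhere to the L² limit, so the two limits
agree. -/
instance : CompleteSpace (WeightedBergman α) := by
  refine Metric.complete_of_cauchySeq_tendsto fun f hf => ?_
  have hiso : Isometry (toLpₗ α) :=
    AddMonoidHomClass.isometry_of_norm (toLpₗ α) fun _ => rfl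
  obtain ⟨G, hG⟩ := cauchySeq_tendsto_of_complete (hiso.uniformContinuous.comp_cauchySeq hf)
  have huc : ∀ w ∈ rightHalfPlaneSet,
      UniformCauchySeqOn (fun n => zeroExt (f n)) Filter.atTop (Metric.ball w (w.re / 4)) := by
    intro w hw
    obtain ⟨C, hC0, hC⟩ := exists_norm_zeroExt_le α hw
    rw [Metric.uniformCauchySeqOn_iff]
    intro ε hε
    obtain ⟨N, hN⟩ := Metric.cauchySeq_iff.1 hf (ε / (C + 1)) (by positivity)
    refine ⟨N, fun m hm n hn z hz => ?_⟩
    rw [dist_eq_norm, ← zeroExt_sub]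
    have h1 := hN m hm n hn
    rw [dist_eq_norm, lt_div_iff₀ (by positivity)] at h1
    calc _ ≤ C * ‖f m - f n‖ := hC _ z hz
      _ ≤ ‖f m - f n‖ * (C + 1) := by nlinarith [norm_nonneg (f m - f n)]
      _ < ε := h1
  have hpt : ∀ z : ℂ, ∃ l, Filter.Tendsto (fun n => zeroExt (f n) z) Filter.atTop (nhds l) := by
    intro z
    by_cases hz : 0 < z.re
    · exact cauchySeq_tendsto_of_complete
        ((huc z hz).cauchySeq (Metric.mem_ball_self (by positivity)))
    · exact ⟨0, by simp [zeroExt_of_notMem _ hz]⟩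
  choose F hFlim using hpt
  have hlu : TendstoLocallyUniformlyOn (fun n => zeroExt (f n)) F Filter.atTop
      rightHalfPlaneSet := by
    intro u hu w hw
    exact ⟨Metric.ball w (w.re / 4),
      mem_nhdsWithin_of_mem_nhds (Metric.ball_mem_nhds w (div_pos hw four_pos)),
      (huc w hw).tendstoUniformlyOn_of_tendsto (fun z _ => hFlim z) u hu⟩
  have hFd : DifferentiableOn ℂ F rightHalfPlaneSet :=
    hlu.differentiableOn (Filter.Eventually.of_forall fun n => (f n).differentiableOn)
      isOpen_rightHalfPlaneSet
  have hae : F =ᵐ[bergmanMeasure α] G := by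
    obtain ⟨ns, hns, hlim⟩ := (tendstoInMeasure_of_tendsto_Lp hG).exists_seq_tendsto_ae
    have hall : ∀ᵐ z ∂bergmanMeasure α, ∀ n, toLpₗ α (f n) z = zeroExt (f n) z :=
      ae_all_iff.2 fun n => (f n).memLp.coeFn_toLp
    filter_upwards [hlim, hall] with z h1 h2
    simp only [Function.comp_apply, h2] at h1
    exact tendsto_nhds_unique ((hFlim z).comp hns.tendsto_atTop) h1
  have hFm : MemLp F 2 (bergmanMeasure α) := (memLp_congr_ae hae).2 (Lp.memLp G)
  have hFz : zeroExt (fun w : RightHalfPlane => F w) = F := by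
    funext z
    by_cases hz : 0 < z.re
    · exact zeroExt_eqOn F hz
    · rw [zeroExt_of_notMem _ hz]
      refine tendsto_nhds_unique ?_ (hFlim z)
      simp [zeroExt_of_notMem _ hz]
  let F' : WeightedBergman α := ⟨fun w => F w, by rwa [hFz], by rwa [hFz]⟩
  have hF' : toLpₗ α F' = G := by
    rw [← Lp.toLp_coeFn G (Lp.memLp G)]
    refine MemLp.toLp_congr F'.memLp _ ?_
    change zeroExt (fun w : RightHalfPlane => F w) =ᵐ[bergmanMeasure α] G
    rwa [hFz]
  exact ⟨F', hiso.isEmbedding.tendsto_nhds_iff.2 (by rwa [hF'])⟩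

noncomputable instance : InnerProductSpace ℂ (WeightedBergman α) where
  inner f g := inner ℂ (toLpₗ α f) (toLpₗ α g)
  norm_sq_eq_re_inner f := norm_sq_eq_re_inner (toLpₗ α f)
  conj_inner_symm f g := inner_conj_symm _ _
  add_left f g h := by rw [map_add, inner_add_left]
  smul_left f g c := by rw [map_smul, inner_smul_left]

end WeightedBergman

/-! ### Affine composition operators and their powers -/

theorem mem_rightHalfPlaneSet {z : ℂ} : z ∈ rightHalfPlaneSet ↔ 0 < z.re := Iff.rfl

theorem affine_re_pos {a : ℝ} {b : ℂ} (ha : 0 < a) (hb : 0 ≤ b.re) {w : ℂ} (hw : 0 < w.re) :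
    0 < ((a : ℂ) * w + b).re := by
  simpa using add_pos_of_pos_of_nonneg (mul_pos ha hw) hb

namespace WeightedBergman

variable {α : ℝ}

theorem differentiableOn_comp_affine {a : ℝ} {b : ℂ} (ha : 0 < a) (hb : 0 ≤ b.re)
    (f : WeightedBergman α) :
    DifferentiableOn ℂ (fun w => zeroExt f (a * w + b)) rightHalfPlaneSet :=
  f.differentiableOn.comp (by fun_prop) fun _ hw => affine_re_pos ha hb hw

/-- The composition operator with symbol `w ↦ a w + b`. -/
noncomputable def affineComp (hα : -1 < α) (a : ℝ) (b : ℂ) (ha : 0 < a) (hb : 0 ≤ b.re) :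
    WeightedBergman α →L[ℂ] WeightedBergman α :=
  LinearMap.mkContinuous
    { toFun := fun f => mk (fun w => zeroExt f (a * w + b)) (differentiableOn_comp_affine ha hb f)
        ((bergmanEnergy_comp_affine_le hα ha hb f.differentiableOn).trans_lt
          (ENNReal.mul_lt_top ENNReal.ofReal_lt_top f.bergmanEnergy_lt_top))
      map_add' := fun f g => DFunLike.ext _ _ fun w => by
        simp only [mk_apply, add_apply, zeroExt_apply_of_pos _ (affine_re_pos ha hb w.2)]
      map_smul' := fun c f => DFunLike.ext _ _ fun w => by
        simp only [mk_apply, smul_apply, zeroExt_apply_of_pos _ (affine_re_pos ha hb w.2),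
          RingHom.id_apply] }
    (√(translationConst α) * a ^ (-((α + 2) / 2))) fun f => by
      have hK := one_le_translationConst hα
      apply norm_le_of_enorm_sq_le (by positivity)
      rw [mul_pow, Real.sq_sqrt (by linarith), ← Real.rpow_mul_natCast ha.le, enorm_sq_eq,
        enorm_sq_eq, mul_left_comm]
      gcongr
      refine le_trans (le_of_eq (bergmanEnergy_congr fun z hz => zeroExt_apply _ ⟨z, hz⟩))
        ((bergmanEnergy_comp_affine_le hα ha hb f.differentiableOn).trans (le_of_eq ?_))
      congr 3
      push_cast
      ring_nf

theorem affineComp_apply (hα : -1 < α) {a : ℝ} {b : ℂ} (ha : 0 < a) (hb : 0 ≤ b.re)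
    (f : WeightedBergman α) (w : RightHalfPlane) :
    affineComp hα a b ha hb f w = f (affineSelfMap a b ha hb w) :=
  zeroExt_apply f (affineSelfMap a b ha hb w)

theorem zeroExt_affineComp (hα : -1 < α) {a : ℝ} {b : ℂ} (ha : 0 < a) (hb : 0 ≤ b.re)
    (f : WeightedBergman α) {z : ℂ} (hz : 0 < z.re) :
    zeroExt (affineComp hα a b ha hb f) z = zeroExt f (a * z + b) :=
  zeroExt_apply _ ⟨z, hz⟩

theorem norm_affineComp_apply_le (hα : -1 < α) {a : ℝ} {b : ℂ} (ha : 0 < a) (hb : 0 ≤ b.re)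
    (f : WeightedBergman α) :
    ‖affineComp hα a b ha hb f‖ ≤ √(translationConst α) * a ^ (-((α + 2) / 2)) * ‖f‖ :=
  ((affineComp hα a b ha hb).le_opNorm f).trans (by
    gcongr
    exact LinearMap.mkContinuous_norm_le _ (by positivity) _)

theorem ext_zeroExt {f g : WeightedBergman α}
    (h : ∀ z : ℂ, 0 < z.re → zeroExt f z = zeroExt g z) : f = g :=
  DFunLike.ext _ _ fun w => by simpa only [zeroExt_apply] using h w w.2

theorem affineComp_congr (hα : -1 < α) {a a' : ℝ} {b b' : ℂ} (ha : 0 < a) (hb : 0 ≤ b.re)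
    (haa : a = a') (hbb : b = b') :
    affineComp hα a b ha hb = affineComp hα a' b' (haa ▸ ha) (hbb ▸ hb) := by
  subst haa hbb; rfl

theorem affineComp_affineComp (hα : -1 < α) {a a' : ℝ} {b b' : ℂ} (ha : 0 < a) (hb : 0 ≤ b.re)
    (ha' : 0 < a') (hb' : 0 ≤ b'.re) (f : WeightedBergman α) :
    affineComp hα a b ha hb (affineComp hα a' b' ha' hb' f) =
      affineComp hα (a' * a) (a' * b + b') (mul_pos ha' ha)
        (by simpa using add_nonneg (mul_nonneg ha'.le hb) hb') f := by
  refine ext_zeroExt fun z hz => ?_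
  rw [zeroExt_affineComp _ _ _ _ hz, zeroExt_affineComp _ _ _ _ (affine_re_pos ha hb hz),
    zeroExt_affineComp _ _ _ _ hz]
  congr 1
  push_cast
  ring

theorem affineComp_one_zero (hα : -1 < α) (f : WeightedBergman α) :
    affineComp hα 1 0 one_pos le_rfl f = f :=
  ext_zeroExt fun z hz => by rw [zeroExt_affineComp _ _ _ _ hz]; simp

/-- The powers of an affine composition operator are affine composition operators. -/
theorem exists_affineComp_pow (hα : -1 < α) {a : ℝ} {b : ℂ} (ha : 0 < a) (hb : 0 ≤ b.re) (n : ℕ) :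
    ∃ (c : ℂ) (hc : 0 ≤ c.re), (b.re = 0 → c.re = 0) ∧ ∀ f,
      (affineComp hα a b ha hb ^ n) f = affineComp hα (a ^ n) c (pow_pos ha n) hc f := by
  induction n with
  | zero =>
    refine ⟨0, le_rfl, fun _ => rfl, fun f => ?_⟩
    rw [pow_zero, affineComp_congr hα _ _ (pow_zero a) rfl, affineComp_one_zero]
    rfl
  | succ n ih =>
    obtain ⟨c, hc, hc0, h⟩ := ih
    refine ⟨a * c + b, by simpa using add_nonneg (mul_nonneg ha.le hc) hb, ?_, fun f => ?_⟩
    · intro hb0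
      simp [hc0 hb0, hb0]
    · rw [pow_succ, mul_apply_eq_comp, h, affineComp_affineComp]
      congr 2
      exact (pow_succ' a n).symm

/-- The one-step bound is applied to the symbol of the n-th power rather than iterated, so √K
appears once and not to the power n. -/
theorem norm_affineComp_pow_apply_le (hα : -1 < α) {a : ℝ} {b : ℂ} (ha : 0 < a) (hb : 0 ≤ b.re)
    (n : ℕ) (f : WeightedBergman α) :
    ‖(affineComp hα a b ha hb ^ n) f‖ ≤
      √(translationConst α) * (a ^ (-((α + 2) / 2))) ^ n * ‖f‖ := by
  obtain ⟨c, hc, -, h⟩ := exists_affineComp_pow hα ha hb n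
  rw [h]
  refine (norm_affineComp_apply_le hα _ hc f).trans (le_of_eq ?_)
  rw [← Real.rpow_natCast_mul ha.le, ← Real.rpow_mul_natCast ha.le, mul_comm (n : ℝ)]

/-- The Bergman space contains the zero-free function `e^{-w} / (1 + w)`. -/
theorem exists_zeroExt_ne_zero (hα : -1 < α) :
    ∃ u : WeightedBergman α, ∀ z : ℂ, 0 < z.re → zeroExt u z ≠ 0 := by
  have hne : ∀ z : ℂ, 0 < z.re → 1 + z ≠ 0 := by
    intro z hz h
    have := congrArg Complex.re h
    simp at this
    linarith
  refine ⟨mk (fun w => Complex.exp (-w) / (1 + w)) ?_ ?_, fun z hz => ?_⟩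
  · exact DifferentiableOn.div (by fun_prop) (by fun_prop) fun z hz => hne z hz
  -- The energy density is dominated by the product of the Gamma integrand in x and 1 / (1 + y²) in
  -- y.
  · have hG : ∫⁻ x in Set.Ioi (0 : ℝ), ENNReal.ofReal (Real.exp (-x) * x ^ α) < ∞ := by
      have := Real.GammaIntegral_convergent (s := α + 1) (by linarith)
      simpa using this.lintegral_lt_top
    have hC : ∫⁻ y : ℝ, ENNReal.ofReal (1 + y ^ 2)⁻¹ < ∞ :=
      integrable_inv_one_add_sq.lintegral_lt_top
    unfold bergmanEnergy
    rw [← lintegral_indicator isOpen_rightHalfPlaneSet.measurableSet, lintegral_complex_eq_prod]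
    refine lt_of_le_of_lt ?_ (ENNReal.mul_lt_top hG hC)
    rw [← lintegral_indicator measurableSet_Ioi, ← lintegral_prod_mul,
      ← Measure.volume_eq_prod]
    · refine lintegral_mono fun p => ?_
      have hre : ((p.1 : ℂ) + p.2 * Complex.I).re = p.1 := by simp
      by_cases hp : 0 < p.1
      · have hmem : ((p.1 : ℂ) + p.2 * Complex.I) ∈ rightHalfPlaneSet := by
          rwa [mem_rightHalfPlaneSet, hre]
        rw [Set.indicator_of_mem hmem, Set.indicator_of_mem (Set.mem_Ioi.2 hp), hre,
          ← ofReal_norm, ← ENNReal.ofReal_pow (norm_nonneg _),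
          ← ENNReal.ofReal_mul (by positivity), ← ENNReal.ofReal_mul (by positivity)]
        refine ENNReal.ofReal_le_ofReal ?_
        have hn : ‖(1 : ℂ) + (p.1 + p.2 * Complex.I)‖ ^ 2 = (1 + p.1) ^ 2 + p.2 ^ 2 := by
          rw [← Complex.normSq_eq_norm_sq, Complex.normSq_apply]
          simp
          ring
        rw [norm_div, div_pow, hn, Complex.norm_exp, Complex.neg_re, hre]
        have h1 : Real.exp (-p.1) ^ 2 ≤ Real.exp (-p.1) := by
          have h2 : Real.exp (-p.1) ≤ 1 := Real.exp_le_one_iff.2 (by linarith)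
          nlinarith [Real.exp_pos (-p.1)]
        have h3 : 1 + p.2 ^ 2 ≤ (1 + p.1) ^ 2 + p.2 ^ 2 := by nlinarith
        calc p.1 ^ α * (Real.exp (-p.1) ^ 2 / ((1 + p.1) ^ 2 + p.2 ^ 2))
            ≤ p.1 ^ α * (Real.exp (-p.1) / (1 + p.2 ^ 2)) := by gcongr
          _ = _ := by ring
      · rw [Set.indicator_of_notMem]
        · exact zero_le
        · rwa [mem_rightHalfPlaneSet, hre]
    · exact (Measurable.indicator (by fun_prop) measurableSet_Ioi).aemeasurable
    · exact (by fun_prop : Measurable fun y : ℝ => ENNReal.ofReal (1 + y ^ 2)⁻¹).aemeasurable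
  · rw [zeroExt_apply_of_pos _ hz, mk_apply]
    exact div_ne_zero (Complex.exp_ne_zero _) (hne z hz)

end WeightedBergman

/-! ### Shadowing for operators on normed spaces -/

section AbstractShadowing

variable {X : Type*} [NormedAddCommGroup X] [NormedSpace ℂ X]

theorem succPNat_add_one (k : ℕ) : k.succPNat + 1 = (k + 1).succPNat := rfl

/-- Positive shadowing in terms of sequences indexed by the natural numbers. -/
theorem hasPositiveShadowing_iff_nat (T : X →L[ℂ] X) :
    HasPositiveShadowing T ↔ ∀ ε : ℝ, 0 < ε → ∃ δ : ℝ, 0 < δ ∧ ∀ z : ℕ → X,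
      (∀ k, ‖T (z k) - z (k + 1)‖ ≤ δ) → ∃ y : X, ∀ k, ‖(T ^ (k + 1)) y - z k‖ ≤ ε := by
  refine forall₂_congr fun ε hε => exists_congr fun δ => and_congr_right fun hδ => ⟨?_, ?_⟩
  · intro h z hz
    obtain ⟨y, hy⟩ := h (fun n => z n.natPred) fun n => by
      have := hz n.natPred
      rwa [← show (n + 1).natPred = n.natPred + 1 by
        rw [← PNat.succPNat_natPred n, succPNat_add_one, Nat.natPred_succPNat,
          Nat.natPred_succPNat]] at this
    refine ⟨y, fun k => ?_⟩
    simpa using hy k.succPNat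
  · intro h x hx
    obtain ⟨y, hy⟩ := h (fun k => x k.succPNat) fun k => hx k.succPNat
    refine ⟨y, fun n => ?_⟩
    have := hy n.natPred
    rwa [PNat.succPNat_natPred, PNat.natPred_add_one] at this

/-- An operator with dense range whose powers decay geometrically has positive shadowing. -/
theorem hasPositiveShadowing_of_contraction {T : X →L[ℂ] X} {L q : ℝ} (hL : 0 < L) (hq0 : 0 ≤ q)
    (hq1 : q < 1) (hT : ∀ (n : ℕ) (x : X), ‖(T ^ n) x‖ ≤ L * q ^ n * ‖x‖) (hd : DenseRange T) :
    HasPositiveShadowing T := by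
  rw [hasPositiveShadowing_iff_nat]
  intro ε hε
  have hq : 0 < 1 - q := by linarith
  refine ⟨ε * (1 - q) / (2 * L), by positivity, fun z hz => ?_⟩
  set δ := ε * (1 - q) / (2 * L) with hδ
  have hδ0 : 0 < δ := by positivity
  -- Carrying T^m through the induction keeps L from being multiplied at each step.
  have key : ∀ k m : ℕ, ‖(T ^ m) (z k - (T ^ k) (z 0))‖ ≤ L * q ^ m * δ / (1 - q) := by
    intro k
    induction k with
    | zero =>
      intro m
      simp only [pow_zero, one_apply_eq_self, sub_self, map_zero, norm_zero]
      positivity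
    | succ k ih =>
      intro m
      have h1 : (T ^ m) (z (k + 1) - (T ^ (k + 1)) (z 0)) =
          (T ^ (m + 1)) (z k - (T ^ k) (z 0)) - (T ^ m) (T (z k) - z (k + 1)) := by
        rw [pow_succ T m, mul_apply_eq_comp, ← map_sub, map_sub T, pow_succ' T k,
          mul_apply_eq_comp]
        congr 1
        abel
      rw [h1]
      calc _ ≤ L * q ^ (m + 1) * δ / (1 - q) + L * q ^ m * δ :=
            (norm_sub_le _ _).trans (add_le_add (ih (m + 1))
              ((hT m _).trans (by gcongr; exact hz k)))
        _ = L * q ^ m * δ / (1 - q) := by field_simp; ring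
  -- The orbit starts at T y, so z 0 must be approximated from the range. This costs ε / 2; δ was
  -- chosen so that the accumulated errors cost the other half.
  obtain ⟨y, hy⟩ := hd.exists_dist_lt (z 0) (show 0 < ε / (2 * L) by positivity)
  refine ⟨y, fun k => ?_⟩
  have h1 := key k 0
  have h2 := hT k (z 0 - T y)
  rw [dist_eq_norm] at hy
  have h3 : (T ^ (k + 1)) y - z k = -((T ^ 0) (z k - (T ^ k) (z 0))) - (T ^ k) (z 0 - T y) := by
    rw [pow_succ, mul_apply_eq_comp, pow_zero, one_apply_eq_self, map_sub]
    abel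
  rw [h3]
  calc _ ≤ L * q ^ 0 * δ / (1 - q) + L * q ^ k * ‖z 0 - T y‖ := by
        refine (norm_sub_le _ _).trans ?_
        rw [norm_neg]
        exact add_le_add h1 h2
    _ ≤ L * q ^ 0 * δ / (1 - q) + L * 1 * (ε / (2 * L)) := by
        gcongr
        exact pow_le_one₀ hq0 hq1.le
    _ = ε := by rw [hδ]; field_simp; ring

/-- An invertible operator on a Banach space such that the powers of its inverse decay
geometrically has positive shadowing. -/
theorem hasPositiveShadowing_of_expansion [CompleteSpace X] {T S : X →L[ℂ] X} {L q : ℝ}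
    (hL : 0 < L) (hq0 : 0 ≤ q) (hq1 : q < 1)
    (hS : ∀ (n : ℕ) (x : X), ‖(S ^ n) x‖ ≤ L * q ^ n * ‖x‖)
    (hTS : ∀ x, T (S x) = x) (hST : ∀ x, S (T x) = x) :
    HasPositiveShadowing T := by
  rw [hasPositiveShadowing_iff_nat]
  intro ε hε
  have hq : 0 < 1 - q := by linarith
  refine ⟨ε * (1 - q) / L, by positivity, fun z hz => ?_⟩
  set δ := ε * (1 - q) / L with hδ
  have hδ0 : 0 < δ := by positivity
  have hstep : ∀ m k : ℕ, ‖(S ^ m) (S (z (k + 1)) - z k)‖ ≤ L * q ^ (m + 1) * δ := by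
    intro m k
    have h1 : S (z (k + 1)) - z k = S (z (k + 1) - T (z k)) := by rw [map_sub, hST]
    rw [h1, ← mul_apply_eq_comp, ← pow_succ]
    refine (hS _ _).trans ?_
    rw [norm_sub_rev]
    gcongr
    exact hz k
  have key : ∀ k n m : ℕ, ‖(S ^ m) ((S ^ k) (z (n + k)) - z n)‖ ≤ L * q ^ m * δ / (1 - q) := by
    intro k
    induction k with
    | zero =>
      intro n m
      simp only [pow_zero, one_apply_eq_self, add_zero, sub_self, map_zero, norm_zero]
      positivity
    | succ k ih =>
      intro n m
      have h1 : (S ^ m) ((S ^ (k + 1)) (z (n + (k + 1))) - z n) =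
          (S ^ (m + 1)) ((S ^ k) (z (n + 1 + k)) - z (n + 1)) +
            (S ^ m) (S (z (n + 1)) - z n) := by
        rw [pow_succ S m, mul_apply_eq_comp, ← map_add, map_sub S, pow_succ' S k,
          mul_apply_eq_comp, show n + (k + 1) = n + 1 + k by ring]
        congr 1
        abel
      rw [h1]
      calc _ ≤ L * q ^ (m + 1) * δ / (1 - q) + L * q ^ (m + 1) * δ :=
            (norm_add_le _ _).trans (add_le_add (ih _ _) (hstep _ _))
        _ ≤ L * q ^ (m + 1) * δ / (1 - q) + L * q ^ m * δ := by
            gcongr _ + L * ?_ * δ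
            exact pow_le_pow_of_le_one hq0 hq1.le (Nat.le_succ m)
        _ = L * q ^ m * δ / (1 - q) := by field_simp; ring
  -- Since T^(k+1) y should be close to z k, the vector y is the limit of the pullbacks of z k.
  have hcauchy : CauchySeq fun k => (S ^ (k + 1)) (z k) := by
    refine cauchySeq_of_le_geometric q (L * q ^ 2 * δ) hq1 fun k => ?_
    rw [dist_comm, dist_eq_norm, pow_succ S (k + 1), mul_apply_eq_comp, ← map_sub]
    refine (hstep _ _).trans (le_of_eq ?_)
    ring
  obtain ⟨y, hy⟩ := cauchySeq_tendsto_of_complete hcauchy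
  have hTSn : ∀ (n : ℕ) (x : X), (T ^ n) ((S ^ n) x) = x := by
    intro n
    induction n with
    | zero => intro x; rfl
    | succ n ih =>
      intro x
      rw [pow_succ T, mul_apply_eq_comp, pow_succ' S, mul_apply_eq_comp, hTS, ih]
  refine ⟨y, fun n => ?_⟩
  have hlim : Filter.Tendsto (fun k => ‖(T ^ (n + 1)) ((S ^ (k + n + 1)) (z (k + n))) - z n‖)
      Filter.atTop (nhds ‖(T ^ (n + 1)) y - z n‖) :=
    ((((T ^ (n + 1)).continuous.tendsto y).comp
      (hy.comp (Filter.tendsto_add_atTop_nat n))).sub_const _).norm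
  refine le_of_tendsto hlim (Filter.Eventually.of_forall fun k => ?_)
  rw [show k + n + 1 = n + 1 + k by ring, pow_add S, mul_apply_eq_comp, hTSn, add_comm k n]
  refine (key k n 0).trans (le_of_eq ?_)
  rw [hδ]
  field_simp

/-- Adding a small multiple v of u at each step gives a pseudo orbit on which ℓ takes the values k ·
ℓ v, while ℓ is constant along a true orbit. -/
theorem not_hasPositiveShadowing_of_invariant_functional {T : X →L[ℂ] X} (ℓ : X →L[ℂ] ℂ)
    (hℓ : ∀ x, ℓ (T x) = ℓ x) {u : X} (hu : ℓ u ≠ 0) : ¬ HasPositiveShadowing T := by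
  rw [hasPositiveShadowing_iff_nat]
  intro h
  obtain ⟨δ, hδ, H⟩ := h 1 one_pos
  set v : X := ((δ / (‖u‖ + 1) : ℝ) : ℂ) • u with hv
  have hvn : ‖v‖ ≤ δ := by
    rw [hv, norm_smul, Complex.norm_real, Real.norm_of_nonneg (by positivity), div_mul_eq_mul_div]
    exact div_le_of_le_mul₀ (by positivity) hδ.le (by nlinarith [norm_nonneg u])
  have hℓv : ℓ v ≠ 0 := by
    rw [hv, map_smul]
    refine smul_ne_zero (Complex.ofReal_ne_zero.2 ?_) hu
    positivity
  obtain ⟨y, hy⟩ := H (fun k => ∑ j ∈ Finset.range k, (T ^ j) v) fun k => by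
    rw [Finset.sum_range_succ', map_sum]
    simp only [pow_succ', mul_apply_eq_comp, pow_zero, one_apply_eq_self]
    rwa [sub_add_cancel_left, norm_neg]
  have hℓn : ∀ (n : ℕ) x, ℓ ((T ^ n) x) = ℓ x := by
    intro n
    induction n with
    | zero => intro x; rfl
    | succ n ih => intro x; rw [pow_succ', mul_apply_eq_comp, hℓ, ih]
  obtain ⟨n, hn⟩ := exists_nat_gt ((‖ℓ y‖ + ‖ℓ‖) / ‖ℓ v‖)
  rw [div_lt_iff₀ (norm_pos_iff.2 hℓv)] at hn
  have h1 := (ℓ.le_opNorm _).trans (mul_le_of_le_one_right (norm_nonneg ℓ) (hy n))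
  simp only [map_sub, hℓn, map_sum, Finset.sum_const, Finset.card_range, nsmul_eq_mul] at h1
  have h2 : ‖(n : ℂ) * ℓ v‖ ≤ ‖ℓ y‖ + ‖ℓ y - n * ℓ v‖ := by
    have := norm_sub_le (ℓ y) (ℓ y - n * ℓ v)
    rwa [sub_sub_cancel] at this
  rw [norm_mul, Complex.norm_natCast] at h2
  linarith

/-- If a power bounded operator has positive shadowing then its orbit sums are bounded. -/
theorem HasPositiveShadowing.exists_norm_orbit_sum_le {T : X →L[ℂ] X} (h : HasPositiveShadowing T)
    {L : ℝ} (hT : ∀ (n : ℕ) (x : X), ‖(T ^ n) x‖ ≤ L * ‖x‖) (u : X) :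
    ∃ C : ℝ, ∀ n : ℕ, ‖∑ j ∈ Finset.range n, (T ^ j) u‖ ≤ C := by
  rw [hasPositiveShadowing_iff_nat] at h
  obtain ⟨δ, hδ, H⟩ := h 1 one_pos
  set c : ℝ := δ / (‖u‖ + 1) with hc
  have hc0 : 0 < c := by positivity
  have hcn : ‖(c : ℂ)‖ = c := by rw [Complex.norm_real, Real.norm_of_nonneg hc0.le]
  have hvn : ‖(c : ℂ) • u‖ ≤ δ := by
    rw [norm_smul, hcn, hc, div_mul_eq_mul_div]
    exact div_le_of_le_mul₀ (by positivity) hδ.le (by nlinarith [norm_nonneg u])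
  -- The partial sums form a pseudo orbit with error exactly c • u; being shadowed by a bounded
  -- orbit, they are bounded.
  obtain ⟨y, hy⟩ := H (fun k => ∑ j ∈ Finset.range k, (T ^ j) ((c : ℂ) • u)) fun k => by
    rw [Finset.sum_range_succ', map_sum]
    simp only [pow_succ', mul_apply_eq_comp, pow_zero, one_apply_eq_self]
    rwa [sub_add_cancel_left, norm_neg]
  refine ⟨(L * ‖y‖ + 1) / c, fun n => ?_⟩
  rw [le_div_iff₀ hc0]
  have h1 := hy n
  have h2 := hT (n + 1) y
  simp only [map_smul, ← Finset.smul_sum] at h1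
  have h3 := norm_sub_norm_le ((c : ℂ) • ∑ j ∈ Finset.range n, (T ^ j) u) ((T ^ (n + 1)) y)
  rw [norm_sub_rev _ ((T ^ (n + 1)) y), norm_smul, hcn] at h3
  linarith

end AbstractShadowing

/-! ### Reproducing kernels, weakly holomorphic translations, dense range -/

namespace WeightedBergman

variable {α : ℝ}

/-- Evaluation at a point of the half-plane, as a continuous linear functional. -/
noncomputable def evalCLM (α : ℝ) (w : RightHalfPlane) : WeightedBergman α →L[ℂ] ℂ :=
  LinearMap.mkContinuous
    { toFun := fun f => f w
      map_add' := fun _ _ => rfl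
      map_smul' := fun _ _ => rfl }
    (exists_norm_zeroExt_le α w.2).choose fun f => by
      have h := (exists_norm_zeroExt_le α w.2).choose_spec.2 f w
        (Metric.mem_ball_self (div_pos w.2 four_pos))
      rwa [zeroExt_apply] at h

@[simp] theorem evalCLM_apply (w : RightHalfPlane) (f : WeightedBergman α) :
    evalCLM α w f = f w := rfl

/-- The reproducing kernel at a point of the half-plane. -/
noncomputable def reproducingKernel (α : ℝ) (w : RightHalfPlane) : WeightedBergman α :=
  (InnerProductSpace.toDual ℂ _).symm (evalCLM α w)

theorem inner_reproducingKernel (w : RightHalfPlane) (f : WeightedBergman α) :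
    inner ℂ (reproducingKernel α w) f = f w := by
  rw [reproducingKernel, InnerProductSpace.toDual_symm_apply, evalCLM_apply]

/-- A function orthogonal to all kernels vanishes at every point. -/
theorem dense_span_reproducingKernel (α : ℝ) :
    Dense (Submodule.span ℂ (Set.range (reproducingKernel α)) : Set (WeightedBergman α)) := by
  rw [← Submodule.topologicalClosure_eq_top_iff.symm.trans
    Submodule.dense_iff_topologicalClosure_eq_top.symm, Submodule.eq_bot_iff]
  intro f hf
  refine DFunLike.ext _ _ fun w => ?_
  rw [← inner_reproducingKernel]
  exact hf _ (Submodule.subset_span ⟨w, rfl⟩)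

open Classical in
/-- Translation by `s` if `0 ≤ Re s`, and zero otherwise. -/
noncomputable def translate (hα : -1 < α) (s : ℂ) : WeightedBergman α →L[ℂ] WeightedBergman α :=
  if h : 0 ≤ s.re then affineComp hα 1 s one_pos h else 0

theorem translate_of_nonneg (hα : -1 < α) {s : ℂ} (h : 0 ≤ s.re) :
    translate hα s = affineComp hα 1 s one_pos h := dif_pos h

theorem zeroExt_translate (hα : -1 < α) {s : ℂ} (h : 0 ≤ s.re) (f : WeightedBergman α) {z : ℂ}
    (hz : 0 < z.re) : zeroExt (translate hα s f) z = zeroExt f (z + s) := by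
  rw [translate_of_nonneg hα h, zeroExt_affineComp _ _ _ _ hz, Complex.ofReal_one, one_mul]

theorem norm_translate_apply_le (hα : -1 < α) (s : ℂ) (f : WeightedBergman α) :
    ‖translate hα s f‖ ≤ √(translationConst α) * ‖f‖ := by
  unfold translate
  split_ifs with h
  · simpa using norm_affineComp_apply_le hα one_pos h f
  · simpa using mul_nonneg (Real.sqrt_nonneg (translationConst α)) (norm_nonneg f)

theorem norm_inner_translate_sub_le (hα : -1 < α) (s : ℂ) (f g g' : WeightedBergman α) :
    ‖inner ℂ g (translate hα s f) - inner ℂ g' (translate hα s f)‖ ≤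
      ‖g - g'‖ * (√(translationConst α) * ‖f‖) := by
  rw [← inner_sub_left]
  exact (norm_inner_le_norm _ _).trans (by gcongr; exact norm_translate_apply_le hα s f)

theorem continuousAt_zeroExt (f : WeightedBergman α) {z : ℂ} (hz : 0 < z.re) :
    ContinuousAt (zeroExt f) z :=
  f.differentiableOn.continuousOn.continuousAt (isOpen_rightHalfPlaneSet.mem_nhds hz)

/-- Translation is weakly holomorphic on the half-plane and weakly continuous at zero. -/
theorem inner_translate_regular_of_mem_span (hα : -1 < α) (f : WeightedBergman α)
    {g : WeightedBergman α} (hg : g ∈ Submodule.span ℂ (Set.range (reproducingKernel α))) :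
    DifferentiableOn ℂ (fun s => inner ℂ g (translate hα s f)) rightHalfPlaneSet ∧
      Filter.Tendsto (fun t : ℝ => inner ℂ g (translate hα t f)) (nhdsWithin 0 (Set.Ioi 0))
        (nhds (inner ℂ g f)) := by
  induction hg using Submodule.span_induction with
  | mem g hg =>
    obtain ⟨w, rfl⟩ := hg
    simp only [inner_reproducingKernel]
    constructor
    · refine DifferentiableOn.congr (f := fun s => zeroExt f (w + s)) ?_ fun s hs => ?_
      · exact f.differentiableOn.comp (by fun_prop) fun s hs => add_pos w.2 hs
      · rw [← zeroExt_apply (translate hα s f), zeroExt_translate hα (le_of_lt hs) f w.2]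
    · have h1 : Filter.Tendsto (fun t : ℝ => zeroExt f (w + t)) (nhdsWithin 0 (Set.Ioi 0))
          (nhds (f w)) := by
        rw [← zeroExt_apply f w]
        have h2 : Filter.Tendsto (fun t : ℝ => (w : ℂ) + t) (nhds 0) (nhds w) := by
          have : Continuous fun t : ℝ => (w : ℂ) + t := by fun_prop
          simpa using this.tendsto 0
        exact ((f.continuousAt_zeroExt w.2).tendsto.comp h2).mono_left nhdsWithin_le_nhds
      refine h1.congr' ?_
      filter_upwards [self_mem_nhdsWithin] with t ht
      rw [← zeroExt_apply (translate hα t f),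
        zeroExt_translate hα (by simpa using le_of_lt ht) f w.2]
  | zero => simp
  | add g g' _ _ h h' =>
    simp only [inner_add_left]
    exact ⟨h.1.add h'.1, h.2.add h'.2⟩
  | smul c g _ h =>
    simp only [inner_smul_left]
    exact ⟨h.1.const_mul _, h.2.const_mul _⟩

/-- Translations are bounded uniformly in s, so approximating g by combinations of kernels gives
convergence uniform in s, which preserves both properties. -/
theorem inner_translate_regular (hα : -1 < α) (f g : WeightedBergman α) :
    DifferentiableOn ℂ (fun s => inner ℂ g (translate hα s f)) rightHalfPlaneSet ∧
      Filter.Tendsto (fun t : ℝ => inner ℂ g (translate hα t f)) (nhdsWithin 0 (Set.Ioi 0))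
        (nhds (inner ℂ g f)) := by
  set L := √(translationConst α) * ‖f‖ with hL
  have hL0 : 0 ≤ L := by positivity
  obtain ⟨u, hu, hlim⟩ := mem_closure_iff_seq_limit.1 (dense_span_reproducingKernel α g)
  have hreg := fun n => inner_translate_regular_of_mem_span hα f (hu n)
  have hunif : TendstoUniformly (fun n s => (inner ℂ (u n) (translate hα s f) : ℂ))
      (fun s => inner ℂ g (translate hα s f)) Filter.atTop := by
    rw [Metric.tendstoUniformly_iff]
    intro ε hε
    have h0 : Filter.Tendsto (fun n => ‖g - u n‖ * L) Filter.atTop (nhds 0) := by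
      have := ((tendsto_const_nhds (x := g)).sub hlim).norm.mul_const L
      simpa using this
    filter_upwards [h0.eventually_lt_const hε] with n hn s
    rw [dist_eq_norm]
    exact (norm_inner_translate_sub_le hα s f g (u n)).trans_lt hn
  constructor
  · exact (hunif.tendstoUniformlyOn.tendstoLocallyUniformlyOn).differentiableOn
      (Filter.Eventually.of_forall fun n => (hreg n).1) isOpen_rightHalfPlaneSet
  · have h1 : Filter.Tendsto (fun n => (inner ℂ (u n) f : ℂ)) Filter.atTop
        (nhds (inner ℂ g f)) := hlim.inner tendsto_const_nhds
    have h2 : TendstoUniformly (fun n (t : ℝ) => (inner ℂ (u n) (translate hα t f) : ℂ))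
        (fun t => inner ℂ g (translate hα t f)) Filter.atTop := hunif.comp _
    exact h2.tendstoUniformlyOnFilter.mono_right le_top |>.tendsto_of_eventually_tendsto
      (Filter.Eventually.of_forall fun n => (hreg n).2) h1

/-- The range contains every translate f(· + b/a + s) with Re s ≥ 0. If g is orthogonal to it, the
holomorphic function s ↦ ⟨g, f(· + s)⟩ vanishes far to the right, hence on the whole half-plane;
with f = g and s → 0 this gives ⟨g, g⟩ = 0. -/
theorem denseRange_affineComp (hα : -1 < α) {a : ℝ} {b : ℂ} (ha : 0 < a) (hb : 0 ≤ b.re) :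
    DenseRange (affineComp hα a b ha hb) := by
  have hdense : Dense ((affineComp hα a b ha hb).range : Set (WeightedBergman α)) := by
    rw [← Submodule.topologicalClosure_eq_top_iff.symm.trans
      Submodule.dense_iff_topologicalClosure_eq_top.symm, Submodule.eq_bot_iff]
    intro g hg
    have ha' : 0 < a⁻¹ := inv_pos.2 ha
    have horth : ∀ (f : WeightedBergman α) (s : ℂ), 0 ≤ s.re →
        inner ℂ g (translate hα ((a⁻¹ : ℝ) * b + s) f) = 0 := by
      intro f s hs
      have hre : 0 ≤ (((a⁻¹ : ℝ) : ℂ) * b + s).re := by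
        simpa using add_nonneg (mul_nonneg ha'.le hb) hs
      have h1 : translate hα ((a⁻¹ : ℝ) * b + s) f =
          affineComp hα a b ha hb (affineComp hα a⁻¹ s ha' hs f) := by
        rw [affineComp_affineComp, translate_of_nonneg hα hre]
        rw [affineComp_congr hα (mul_pos ha' ha) _ (inv_mul_cancel₀ ha.ne') rfl]
      rw [h1]
      exact Submodule.inner_left_of_mem_orthogonal (LinearMap.mem_range_self _ _) hg
    have hzero : ∀ (f : WeightedBergman α) (s : ℂ), 0 < s.re →
        inner ℂ g (translate hα s f) = 0 := by
      intro f
      have hA := (inner_translate_regular hα f g).1.analyticOnNhd isOpen_rightHalfPlaneSet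
      have hpre : IsPreconnected rightHalfPlaneSet := (convex_halfSpace_re_gt 0).isPreconnected
      have hc : 0 ≤ (((a⁻¹ : ℝ) : ℂ) * b).re := by simpa using mul_nonneg ha'.le hb
      have hmem : ((a⁻¹ : ℝ) : ℂ) * b + 1 ∈ rightHalfPlaneSet := by
        rw [mem_rightHalfPlaneSet, Complex.add_re, Complex.one_re]
        linarith
      refine hA.eqOn_zero_of_preconnected_of_eventuallyEq_zero hpre hmem ?_
      have hopen : IsOpen {s : ℂ | (((a⁻¹ : ℝ) : ℂ) * b).re < s.re} :=
        isOpen_lt continuous_const Complex.continuous_re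
      filter_upwards [hopen.mem_nhds (show (((a⁻¹ : ℝ) : ℂ) * b).re <
        (((a⁻¹ : ℝ) : ℂ) * b + 1).re by simp)] with s hs
      have := horth f (s - ((a⁻¹ : ℝ) : ℂ) * b) (by rw [Complex.sub_re]; exact sub_nonneg.2 hs.le)
      rwa [add_sub_cancel] at this
    have hg0 : inner ℂ g g = 0 := by
      refine tendsto_nhds_unique (inner_translate_regular hα g g).2 ?_
      refine (tendsto_const_nhds (x := (0 : ℂ))).congr' ?_
      filter_upwards [self_mem_nhdsWithin] with t ht
      exact (hzero g t (by simpa using ht)).symm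
    exact inner_self_eq_zero.1 hg0
  exact hdense

/-! ### The cases of the theorem -/

theorem zeroExt_translation_pow (hα : -1 < α) {b : ℂ} (hb : 0 ≤ b.re) (n : ℕ)
    (f : WeightedBergman α) {z : ℂ} (hz : 0 < z.re) :
    zeroExt ((affineComp hα 1 b one_pos hb ^ n) f) z = zeroExt f (z + n * b) := by
  induction n generalizing z with
  | zero => simp
  | succ n ih =>
    have hz' : 0 < (z + b).re := by rw [Complex.add_re]; linarith
    rw [pow_succ', mul_apply_eq_comp, zeroExt_affineComp _ _ _ _ hz, Complex.ofReal_one, one_mul,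
      ih hz']
    push_cast
    ring_nf

theorem zeroExt_sum {ι : Type*} (s : Finset ι) (f : ι → WeightedBergman α) {z : ℂ}
    (hz : 0 < z.re) :
    zeroExt (∑ i ∈ s, f i : WeightedBergman α) z = ∑ i ∈ s, zeroExt (f i) z := by
  simp only [zeroExt_apply_of_pos _ hz, ← evalCLM_apply, map_sum]

theorem not_hasPositiveShadowing_translation (hα : -1 < α) {b : ℂ} (hb : 0 ≤ b.re) :
    ¬ HasPositiveShadowing (affineComp hα 1 b one_pos hb) := by
  intro h
  set T := affineComp hα 1 b one_pos hb with hT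
  set L := √(translationConst α) with hL
  have hpow : ∀ (n : ℕ) (f : WeightedBergman α), ‖(T ^ n) f‖ ≤ L * ‖f‖ := fun n f => by
    simpa using norm_affineComp_pow_apply_le hα one_pos hb n f
  obtain ⟨M, hM⟩ := banach_steinhaus (g := fun n : ℕ => ∑ j ∈ Finset.range n, T ^ j) fun f => by
    obtain ⟨C, hC⟩ := h.exists_norm_orbit_sum_le hpow f
    exact ⟨C, fun n => by simpa using hC n⟩
  obtain ⟨u, hu⟩ := exists_zeroExt_ne_zero hα
  obtain ⟨C, hC0, hC⟩ := exists_norm_zeroExt_le α (w := 1) (by simp)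
  have h1re : 0 < (1 : ℂ).re := by simp
  have hbound : ∀ (n : ℕ) (s : ℝ), 0 < s →
      ‖∑ j ∈ Finset.range n, zeroExt u (1 + s * (j * b))‖ ≤ C * (L * (M * (L * ‖u‖))) := by
    intro n s hs
    have hs' : 0 < s⁻¹ := inv_pos.2 hs
    -- Conjugation by the dilation of ratio s turns translation by b into translation by s b.
    set v := affineComp hα s 0 hs le_rfl u with hv
    set x := affineComp hα s⁻¹ 0 hs' le_rfl (∑ j ∈ Finset.range n, (T ^ j) v) with hx
    have hval : zeroExt x 1 = ∑ j ∈ Finset.range n, zeroExt u (1 + s * (j * b)) := by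
      have hsre : 0 < ((s⁻¹ : ℝ) * 1 + 0 : ℂ).re := affine_re_pos hs' le_rfl h1re
      rw [hx, zeroExt_affineComp _ _ _ _ h1re, zeroExt_sum _ _ hsre]
      refine Finset.sum_congr rfl fun j _ => ?_
      have hjre : 0 < ((s⁻¹ : ℝ) * 1 + 0 + j * b : ℂ).re := by
        rw [Complex.add_re]
        have : 0 ≤ ((j : ℂ) * b).re := by simpa using mul_nonneg j.cast_nonneg hb
        linarith
      rw [hT, zeroExt_translation_pow hα hb j v hsre, hv, zeroExt_affineComp _ _ _ _ hjre]
      congr 1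
      have : (s : ℂ) ≠ 0 := Complex.ofReal_ne_zero.2 hs.ne'
      push_cast
      field_simp
      ring
    -- The norm factors of the two dilations cancel, which makes the bound independent of s.
    have hp : s⁻¹ ^ (-((α + 2) / 2)) * s ^ (-((α + 2) / 2)) = 1 := by
      rw [← Real.mul_rpow hs'.le hs.le, inv_mul_cancel₀ hs.ne', Real.one_rpow]
    have hM0 : 0 ≤ M := (norm_nonneg _).trans (hM 0)
    rw [← hval]
    refine (hC x 1 (Metric.mem_ball_self (by simp))).trans ?_
    gcongr
    calc ‖x‖ ≤ L * s⁻¹ ^ (-((α + 2) / 2)) * ‖∑ j ∈ Finset.range n, (T ^ j) v‖ :=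
          norm_affineComp_apply_le hα hs' le_rfl _
      _ ≤ L * s⁻¹ ^ (-((α + 2) / 2)) * (M * (L * s ^ (-((α + 2) / 2)) * ‖u‖)) := by
          gcongr
          have h2 := ContinuousLinearMap.le_of_opNorm_le _ (hM n) v
          rw [sum_apply] at h2
          refine h2.trans ?_
          gcongr
          exact norm_affineComp_apply_le hα hs le_rfl u
      _ = (s⁻¹ ^ (-((α + 2) / 2)) * s ^ (-((α + 2) / 2))) * (L * (M * (L * ‖u‖))) := by ring
      _ = L * (M * (L * ‖u‖)) := by rw [hp, one_mul]
  -- As s → 0 all n evaluation points tend to 1, while the bound depends on neither s nor n.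
  have hlim : ∀ n : ℕ, n * ‖zeroExt u 1‖ ≤ C * (L * (M * (L * ‖u‖))) := by
    intro n
    have ht : Filter.Tendsto
        (fun s : ℝ => ‖∑ j ∈ Finset.range n, zeroExt u (1 + s * (j * b))‖)
        (nhdsWithin 0 (Set.Ioi 0)) (nhds ‖∑ j ∈ Finset.range n, zeroExt u 1‖) := by
      refine (tendsto_finsetSum _ fun j _ => ?_).norm
      have h2 : Filter.Tendsto (fun s : ℝ => (1 : ℂ) + s * (j * b)) (nhds 0) (nhds 1) := by
        have : Continuous fun s : ℝ => (1 : ℂ) + s * (j * b) := by fun_prop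
        simpa using this.tendsto 0
      exact ((u.continuousAt_zeroExt h1re).tendsto.comp h2).mono_left nhdsWithin_le_nhds
    have := le_of_tendsto ht (by
      filter_upwards [self_mem_nhdsWithin] with s hs using hbound n s hs)
    simpa using this
  obtain ⟨n, hn⟩ := exists_nat_gt (C * (L * (M * (L * ‖u‖))) / ‖zeroExt u 1‖)
  rw [div_lt_iff₀ (norm_pos_iff.2 (hu 1 h1re))] at hn
  exact absurd (hlim n) (not_le.2 hn)

theorem not_hasPositiveShadowing_of_fixedPoint (hα : -1 < α) {a : ℝ} {b : ℂ} (ha : 0 < a)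
    (ha1 : a < 1) (hb : 0 < b.re) : ¬ HasPositiveShadowing (affineComp hα a b ha hb.le) := by
  have h1a : 0 < (1 - a)⁻¹ := inv_pos.2 (by linarith)
  have hw : 0 < (((1 - a)⁻¹ : ℝ) * b : ℂ).re := by
    rw [Complex.re_ofReal_mul]
    exact mul_pos h1a hb
  obtain ⟨u, hu⟩ := exists_zeroExt_ne_zero hα
  refine not_hasPositiveShadowing_of_invariant_functional (evalCLM α ⟨_, hw⟩) (fun f => ?_)
    (u := u) ?_
  · rw [evalCLM_apply, evalCLM_apply, affineComp_apply]
    congr 1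
    apply Subtype.ext
    have : (1 - a : ℂ) ≠ 0 := by
      rw [← Complex.ofReal_one, ← Complex.ofReal_sub]
      exact Complex.ofReal_ne_zero.2 (by linarith)
    simp only [affineSelfMap]
    push_cast
    field_simp
    ring
  · exact fun h0 => hu _ hw ((zeroExt_apply_of_pos _ hw).trans h0)

theorem hasPositiveShadowing_of_one_lt (hα : -1 < α) {a : ℝ} {b : ℂ} (ha : 0 < a) (hb : 0 ≤ b.re)
    (h1 : 1 < a) : HasPositiveShadowing (affineComp hα a b ha hb) := by
  have hK := one_le_translationConst hα
  exact hasPositiveShadowing_of_contraction (Real.sqrt_pos.2 (by linarith))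
    (Real.rpow_nonneg ha.le _) (Real.rpow_lt_one_of_one_lt_of_neg h1 (by linarith))
    (norm_affineComp_pow_apply_le hα ha hb) (denseRange_affineComp hα ha hb)

theorem hasPositiveShadowing_of_lt_one (hα : -1 < α) {a : ℝ} {b : ℂ} (ha : 0 < a) (hb : 0 ≤ b.re)
    (h1 : a < 1) (hb0 : b.re = 0) : HasPositiveShadowing (affineComp hα a b ha hb) := by
  have hK := one_le_translationConst hα
  have ha' : 0 < a⁻¹ := inv_pos.2 ha
  have hac : (a : ℂ) ≠ 0 := Complex.ofReal_ne_zero.2 ha.ne'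
  have hc : (0 : ℝ) ≤ (-((a⁻¹ : ℝ) * b) : ℂ).re := by
    rw [Complex.neg_re, Complex.re_ofReal_mul, hb0, mul_zero, neg_zero]
  refine hasPositiveShadowing_of_expansion
    (S := affineComp hα a⁻¹ (-((a⁻¹ : ℝ) * b)) ha' hc) (Real.sqrt_pos.2 (by linarith))
    (Real.rpow_nonneg ha'.le _)
    (Real.rpow_lt_one_of_one_lt_of_neg ((one_lt_inv₀ ha).2 h1) (by linarith))
    (norm_affineComp_pow_apply_le hα ha' hc) (fun f => ext_zeroExt fun z hz => ?_)
    (fun f => ext_zeroExt fun z hz => ?_)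
  · rw [zeroExt_affineComp _ _ _ _ hz, zeroExt_affineComp _ _ _ _ (affine_re_pos ha hb hz)]
    congr 1
    push_cast
    field_simp
    ring
  · rw [zeroExt_affineComp _ _ _ _ hz, zeroExt_affineComp _ _ _ _ (affine_re_pos ha' hc hz)]
    congr 1
    push_cast
    field_simp
    ring

end WeightedBergman

theorem mainTheorem1 (α : ℝ) (hα : -1 < α) (a : ℝ) (b : ℂ) (ha : 0 < a) (hb : 0 ≤ b.re) :
    ∃ C : WeightedBergman α →L[ℂ] WeightedBergman α,
      IsCompositionOperator C (affineSelfMap a b ha hb) ∧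
      (HasPositiveShadowing C ↔ (a < 1 ∧ b.re = 0) ∨ 1 < a) := by
  refine ⟨WeightedBergman.affineComp hα a b ha hb, WeightedBergman.affineComp_apply hα ha hb,
    fun h => ?_, ?_⟩
  · rcases lt_trichotomy a 1 with h1 | rfl | h1
    · refine Or.inl ⟨h1, ?_⟩
      by_contra hne
      exact WeightedBergman.not_hasPositiveShadowing_of_fixedPoint hα ha h1
        (lt_of_le_of_ne hb (Ne.symm hne)) h
    · exact absurd h (WeightedBergman.not_hasPositiveShadowing_translation hα hb)
    · exact Or.inr h1
  · rintro (⟨h1, hb0⟩ | h1)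
    · exact WeightedBergman.hasPositiveShadowing_of_lt_one hα ha hb h1 hb0
    · exact WeightedBergman.hasPositiveShadowing_of_one_lt hα ha hb h1
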